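/- **Setting.** Let $G=(V,E)$ be a finite connected undirected graph, $m\ge 0$, $\mathbf X=(\mathbb R^m)^{V}$, $\bar{\mathbf x}\in\mathbf X$, $\bar E=E\times\{1,\dots,m\}$, and for $\alpha=(\{i,j\},k)\in\bar E$ let $H_\alpha=\{\mathbf x\in\mathbf X:[[\mathbf x]_i]_k=[[\mathbf x]_j]_k\}$; put $D=\bigcap_{\alpha\in\bar E}H_\alpha$. For $i\in V$ let $f_i:\mathbb R^m\to\mathbb R\cup\{\infty\}$ be closed convex, with $\bigcap_i\mathrm{dom} f_i\neq\emptyset$. Let $V=V_1\sqcup V_2\sqcup V_3\sqcup V_4$, where $f_i$ is the indicator function of a closed convex set for $i\in V_2$, and $\mathrm{dom} f_i=\mathbb R^m$ for $i\in V_3\cup V_4$. The primal problem is $\min_{x\in\mathbb R^m}\sum_{i\in V}\big[\tfrac12\|x-[\bar{\mathbf x}]_i\|^2+f_i(x)\big]$. With $\mathbf f_i(\mathbf x)=f_i([\mathbf x]_i)$ for $i\in V$ and $\mathbf f_\alpha=\delta_{H_\alpha}$ for $\alpha\in\bar E$, the dual problem is to maximize, over $\mathbf z=\{\mathbf z_\alpha\}_{\alpha\in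 V\cup\bar E}$ with $\mathbf z_\alpha\in\mathbf X$, $$F(\mathbf z)=-\tfrac12\Big\|\bar{\mathbf x}-\sum_{\alpha\in V\cup\bar E}\mathbf z_\alpha\Big\|^2+\tfrac12\|\bar{\mathbf x}\|^2-\sum_{\alpha\in V\cup\bar E}\mathbf f_\alpha^*(\mathbf z_\alpha).$$ **Algorithm (distributed Dykstra).** Fix an integer $\bar w\ge1$ and $C_{reg}>0$. Write $\mathbf v_H^{n,w}=\sum_{\alpha\in\bar E}\mathbf z_\alpha^{n,w}$. For $i\in V_4$ the algorithm maintains convex models $f_{i,n,w}:\mathbb R^m\to\mathbb R$; put $\mathbf f_{i,n,w}(\mathbf x)=f_{i,n,w}([\mathbf x]_i)$ for $i\in V_4$ and $\mathbf f_{\alpha,n,w}=\mathbf f_\alpha$ for $\alpha\notin V_4$, and let $F^{n,w}$ be $F$ with every $\mathbf f_\alpha$ replaced by $\mathbf f_{\alpha,n,w}$. Start with $\mathbf z_i^{1,0}$ ($i\in V$) whose blocks $[\mathbf z_i^{1,0}]_j$, $j\ne i$, vanish, with $\mathbf v_H^{1,0}\in D^\perp$, and with convex $f_{i,1,0}\le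 f_i$ ($i\in V_4$). For $n=1,2,\dots$: 1. Choose $\bar E_n\subseteq\bar E$ with $\bigcap_{\alpha\in\bar E_n}H_\alpha=D$, and $\mathbf z_\alpha^{n,0}\in H_\alpha^\perp$ ($\alpha\in\bar E$) with $\mathbf z_\alpha^{n,0}=0$ for $\alpha\notin\bar E_n$, $\|\mathbf z_\alpha^{n,0}\|\le C_{reg}\|\mathbf v_H^{n,0}\|$ and $\sum_{\alpha\in\bar E}\mathbf z_\alpha^{n,0}=\mathbf v_H^{n,0}$. 2. For $w=1,\dots,\bar w$ choose a nonempty $S_{n,w}\subseteq\bar E_n\cup V$ and put $\mathbf z_\alpha^{n,w}=\mathbf z_\alpha^{n,w-1}$ for $\alpha\notin S_{n,w}$. - If $S_{n,w}\not\subseteq V_4$: put $f_{i,n,w}=f_{i,n,w-1}$ for all $i\in V_4$, and let $\{\mathbf z_\alpha^{n,w}\}_{\alpha\in S_{n,w}}$ be a minimizer of $\tfrac12\|\bar{\mathbf x}-\sum_{\alpha\notin S_{n,w}}\mathbf z_\alpha^{n,w-1}-\sum_{\alpha\in S_{n,w}}\mathbf z_\alpha\|^2+\sum_{\alpha\in S_{n,w}}\mathbf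 f_{\alpha,n,w}^*(\mathbf z_\alpha)$. - If $S_{n,w}\subseteq V_4$: put $f_{i,n,w}=f_{i,n,w-1}$ for $i\in V_4\setminus S_{n,w}$. For each $i\in S_{n,w}$ let $c=[\bar{\mathbf x}-\mathbf v_H^{n,w-1}]_i$, $p=[\bar{\mathbf x}-\mathbf v_H^{n,w-1}-\mathbf z_i^{n,w-1}]_i$, $s\in\partial f_i(p)$ and $\varphi(x)=\max\{f_{i,n,w-1}(x),\,f_i(p)+\langle s,x-p\rangle\}$. Let $x^+$ and $z^+$ be the primal and dual solutions of $\min_x\tfrac12\|c-x\|^2+\varphi(x)$, i.e. $x^+$ is its minimizer and $z^+$ minimizes $\tfrac12\|c-z\|^2+\varphi^*(z)$. Put $f_{i,n,w}(x)=\varphi(x^+)+\langle x-x^+,c-x^+\rangle$, $[\mathbf z_i^{n,w}]_i=z^+$ and $[\mathbf z_i^{n,w}]_j=0$ for $j\neq i$. 3. Put $\mathbf z_i^{n+1,0}=\mathbf z_i^{n,\bar w}$ for $i\in V$, $\mathbf v_H^{n+1,0}=\mathbf v_H^{n,\bar w}$, and $f_{i,n+1,0}=f_{i,n,\bar w}$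 for $i\in V_4$. **Standing assumptions.** For all $n\ge1$: $\bar E_n=\bar E\cap\bigcup_{w=1}^{\bar w}S_{n,w}$ and $V\subseteq\bigcup_{w=1}^{\bar w}S_{n,w}$. Moreover: (1) whenever $w>1$ and $S_{n,w}\subseteq V_4$, for every $i\in V_4$ the vector $[\mathbf z_i^{n,w-1}]_i$ minimizes $\tfrac12\|[\bar{\mathbf x}-\mathbf v_H^{n,w-1}]_i-z\|^2+f_{i,n,w-1}^*(z)$ over $z\in\mathbb R^m$; (2) for $n\ge1$ and $i\in V_4$, if $w\le\bar w$ is larger than every $w'\le\bar w$ with $i\in S_{n,w'}$, then for all $\alpha\in S_{n,w}\cap\bar E$ every $\mathbf v\in H_\alpha^\perp$ satisfies $[\mathbf v]_i=0$; (3) if $V_4\ne\emptyset$, then $S_{n,1}=V_4$ for all $n>1$. **Statement (Corollary).** Let $x^*$ be the minimizer of the primal problem, and suppose that the constraint qualification holds: $$y_i\in N_{\mathrm{cl}(\mathrm{dom}(f_i))}(x^*)\ \ (i\in V_1\cup V_2),\quad \sum_{i\in V_1\cup V_2}y_i=0\quad\Longrightarrow\quad y_i=0\ \ (i\in V_1\cup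 V_2).$$ Then the node dual iterates $\{\mathbf z_i^{n,w}\}$, $i\in V$, $n\ge1$, $0\le w\le\bar w$, of the algorithm are bounded. Moreover the dual problem has an optimizer, and for every dual optimizer $\mathbf z^*$ the value $F(\mathbf z^*)$ is finite, $h^n:=F(\mathbf z^*)-F^{n,0}(\mathbf z^{n,0})$ is nonnegative for all $n\ge1$, and there is a constant $C$ such that $h^n\le C/n^{1/3}$ for all $n\ge2$; that is, the dual objective value converges to its optimum at the rate $O(1/n^{1/3})$. -/

import Mathlib

open scoped InnerProductSpace

noncomputable section

/-! ### Extended-real convex analysis -/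

section ConvexAnalysis

variable {H : Type*} [NormedAddCommGroup H] [InnerProductSpace ℝ H]

/-- A closed convex function `H → ℝ ∪ {∞}`: it never takes the value `-∞`, its epigraph is convex,
and it is lower semicontinuous. -/
structure IsClosedConvex (f : H → EReal) : Prop where
  ne_bot : ∀ x, f x ≠ ⊥
  convex_epi : Convex ℝ {p : H × ℝ | f p.1 ≤ (p.2 : EReal)}
  lsc : LowerSemicontinuous f

/-- The effective domain. -/
def effDom (f : H → EReal) : Set H := {x | f x ≠ ⊤}

open Classical in
/-- The indicator function `δ_C` of convex analysis: `0` on `C` and `∞` off `C`. -/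
def indicatorFun (C : Set H) : H → EReal := fun x => if x ∈ C then 0 else ⊤

/-- The Fenchel conjugate `f*(z) = sup_x (⟪z, x⟫ - f x)`. -/
def fenchelConj (f : H → EReal) (z : H) : EReal :=
  ⨆ x : H, ((⟪z, x⟫_ℝ : ℝ) : EReal) - f x

/-- `s ∈ ∂f(p)`. -/
def IsSubgradientAt (f : H → EReal) (s p : H) : Prop :=
  f p ≠ ⊤ ∧ ∀ x, f p + ((⟪s, x - p⟫_ℝ : ℝ) : EReal) ≤ f x

/-- The normal cone of convex analysis to the set `C` at the point `x`. -/
def normalConeAt (C : Set H) (x : H) : Set H :=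
  {y | x ∈ C ∧ ∀ c ∈ C, ⟪y, c - x⟫_ℝ ≤ 0}

/-- The primal objective `½‖c - x‖² + φ(x)` of a proximal problem with centre `c`. -/
def proxObj (c : H) (φ : H → EReal) (x : H) : EReal :=
  (((1 / 2 : ℝ) * ‖c - x‖ ^ 2 : ℝ) : EReal) + φ x

/-- `x` solves the proximal problem `min_x ½‖c - x‖² + φ(x)`. -/
def IsProxPrimalSol (c : H) (φ : H → EReal) (x : H) : Prop :=
  ∀ y, proxObj c φ x ≤ proxObj c φ y

/-- `z` solves `min_z ½‖c - z‖² + φ*(z)`, which is, up to the sign and the constant `½‖c‖²`,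
the Fenchel dual of the proximal problem. -/
def IsProxDualSol (c : H) (φ : H → EReal) (z : H) : Prop :=
  IsProxPrimalSol c (fenchelConj φ) z

end ConvexAnalysis

/-! ### The distributed problem -/

/-- The Euclidean space `ℝ^m`. -/
abbrev Euc (m : ℕ) : Type := EuclideanSpace ℝ (Fin m)

/-- The product Hilbert space `𝐗 = (ℝ^m)^V`. -/
abbrev ProdSpace (V : Type*) (m : ℕ) : Type _ := PiLp 2 (fun _ : V => Euc m)

/-- The classes `V₁, V₂, V₃, V₄` into which the nodes are partitioned. -/
inductive NodeClass where
  | V₁ | V₂ | V₃ | V₄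

/-- The index set `Ē = E × {1, …, m}`. -/
def EdgeIdx {V : Type*} (G : SimpleGraph V) (m : ℕ) : Type _ := G.edgeSet × Fin m

instance {V : Type*} [Fintype V] (G : SimpleGraph V) (m : ℕ) : Fintype (EdgeIdx G m) :=
  haveI : Finite (EdgeIdx G m) := inferInstanceAs (Finite (G.edgeSet × Fin m))
  Fintype.ofFinite _

/-- The index set `V ∪ Ē` of the dual variables. -/
abbrev DualIdx {V : Type*} (G : SimpleGraph V) (m : ℕ) : Type _ := V ⊕ EdgeIdx G m

/-- The data of the problem `min_x ∑_i (½‖x - x̄_i‖² + f_i(x))` over a connected graph. -/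
structure DistProblem (V : Type*) [Fintype V] (m : ℕ) where
  G : SimpleGraph V
  connected : G.Connected
  xbar : ProdSpace V m
  f : V → Euc m → EReal
  cls : V → NodeClass
  closedConvex : ∀ i, IsClosedConvex (f i)
  cls_two : ∀ i, cls i = .V₂ →
    ∃ C : Set (Euc m), IsClosed C ∧ Convex ℝ C ∧ f i = indicatorFun C
  cls_three : ∀ i, cls i = .V₃ → effDom (f i) = Set.univ
  cls_four : ∀ i, cls i = .V₄ → effDom (f i) = Set.univ
  feasible : ∃ x, ∀ i, x ∈ effDom (f i)

/-- The extension `𝐟_i(𝐱) = f_i([𝐱]_i)` of a function of the `i`-th block to `𝐗`. -/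
def liftFun {V : Type*} {m : ℕ} (i : V) (φ : Euc m → EReal) : ProdSpace V m → EReal :=
  fun x => φ (x i)

/-- The subspace `H_{((i,j),k)} = {𝐱 : [[𝐱]_i]_k = [[𝐱]_j]_k}`. -/
def edgeSubspace {V : Type*} {G : SimpleGraph V} {m : ℕ} (a : EdgeIdx G m) :
    Submodule ℝ (ProdSpace V m) where
  carrier := {x | ∀ i ∈ (a.1 : Sym2 V), ∀ j ∈ (a.1 : Sym2 V), x i a.2 = x j a.2}
  zero_mem' := by intro i _ j _; simp
  add_mem' := by
    intro x y hx hy i hi j hj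
    simp [hx i hi j hj, hy i hi j hj]
  smul_mem' := by
    intro c x hx i hi j hj
    simp [hx i hi j hj]

/-- A set `E' ⊆ Ē` connects `V` if `⋂_{α ∈ E'} H_α = ⋂_{α ∈ Ē} H_α`. -/
def ConnectsV {V : Type*} {G : SimpleGraph V} {m : ℕ} (E' : Set (EdgeIdx G m)) : Prop :=
  (⨅ a ∈ E', edgeSubspace a) = ⨅ a : EdgeIdx G m, edgeSubspace a

namespace DistProblem

variable {V : Type*} [Fintype V] {m : ℕ} (P : DistProblem V m)

/-- The functions `𝐟_α : 𝐗 → ℝ ∪ {∞}`, `α ∈ V ∪ Ē`. -/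
def bigF : DualIdx P.G m → ProdSpace V m → EReal
  | .inl i => liftFun i (P.f i)
  | .inr a => indicatorFun (edgeSubspace a : Set (ProdSpace V m))

/-- The dual objective
`-½‖x̄ - ∑ z_α‖² + ½‖x̄‖² - ∑ φ_α*(z_α)` for a given family of functions `φ_α`. -/
def dualObj (φ : DualIdx P.G m → ProdSpace V m → EReal)
    (z : DualIdx P.G m → ProdSpace V m) : EReal :=
  ((-(1 / 2 : ℝ) * ‖P.xbar - ∑ a, z a‖ ^ 2 + (1 / 2 : ℝ) * ‖P.xbar‖ ^ 2 : ℝ) : EReal)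
    - ∑ a, fenchelConj (φ a) (z a)

/-- `z` is an optimizer of the dual problem `max_z F(z)`. -/
def IsDualOptimizer (z : DualIdx P.G m → ProdSpace V m) : Prop :=
  ∀ y, P.dualObj P.bigF y ≤ P.dualObj P.bigF z

/-- The primal objective `∑_i (½‖x - x̄_i‖² + f_i(x))` on `ℝ^m`. -/
def primalObj (x : Euc m) : EReal :=
  ∑ i, ((((1 / 2 : ℝ) * ‖x - P.xbar i‖ ^ 2 : ℝ) : EReal) + P.f i x)

/-- `x` is a minimizer of the primal problem. -/
def IsPrimalMinimizer (x : Euc m) : Prop := ∀ y, P.primalObj x ≤ P.primalObj y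

open Classical in
/-- The constraint qualification at `x`: if `y_i ∈ N_{cl dom f_i}(x)` for `i ∈ V₁ ∪ V₂` and
`∑_{i ∈ V₁ ∪ V₂} y_i = 0`, then all these `y_i` vanish. -/
def ConstraintQualification (x : Euc m) : Prop :=
  ∀ y : V → Euc m,
    (∀ i, P.cls i = .V₁ ∨ P.cls i = .V₂ → y i ∈ normalConeAt (closure (effDom (P.f i))) x) →
    ∑ i with P.cls i = .V₁ ∨ P.cls i = .V₂, y i = 0 →
    ∀ i, P.cls i = .V₁ ∨ P.cls i = .V₂ → y i = 0

/-! ### The algorithm -/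

/-- The sequences generated by the algorithm. Only `n ≥ 1` and `w ≤ wbar` (`w ≥ 1` for `S`)
matter; `fm n w i` matters only for `i ∈ V₄`. -/
structure Trace where
  /-- the number `w̄` of inner steps -/
  wbar : ℕ
  /-- the constant in the bound on the redistributed edge variables -/
  Creg : ℝ
  /-- the sets `Ē_n` -/
  Ebar : ℕ → Set (EdgeIdx P.G m)
  /-- the sets `S_{n,w}` -/
  S : ℕ → ℕ → Finset (DualIdx P.G m)
  /-- the dual variables `z_α^{n,w}` -/
  z : ℕ → ℕ → DualIdx P.G m → ProdSpace V m
  /-- the models `f_{i,n,w} : ℝ^m → ℝ` of `f_i`, `i ∈ V₄` -/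
  fm : ℕ → ℕ → V → Euc m → ℝ

variable {P}

namespace Trace

variable (T : P.Trace)

/-- `v_H^{n,w} = ∑_{α ∈ Ē} z_α^{n,w}`. -/
def vH (n w : ℕ) : ProdSpace V m := ∑ a : EdgeIdx P.G m, T.z n w (.inr a)

open Classical in
/-- The functions `𝐟_{α,n,w}`: the model for `α ∈ V₄`, and `𝐟_α` otherwise. -/
def bigFm (n w : ℕ) : DualIdx P.G m → ProdSpace V m → EReal
  | .inl i => if P.cls i = .V₄ then liftFun i (fun x => (T.fm n w i x : EReal))
      else P.bigF (.inl i)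
  | .inr a => P.bigF (.inr a)

/-- The value `F^{n,w}(z^{n,w})` of the dual objective. -/
def dualValue (n w : ℕ) : EReal := P.dualObj (T.bigFm n w) (T.z n w)

/-- `S_{n,w} ⊆ V₄`. -/
def StepInV4 (n w : ℕ) : Prop := ∀ a ∈ T.S n w, ∃ i, a = .inl i ∧ P.cls i = .V₄

/-- The prox centre `[x̄ - v_H^{n,w}]_i`. -/
def centre (n w : ℕ) (i : V) : Euc m := (P.xbar - T.vH n w) i

/-- The subalgorithm at node `i ∈ V₄` in step `(n, w + 1)`: the model `f_{i,n,w}` is combined with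
the linearization `ft` of `f_i` at `[x̄ - v_H^{n,w} - z_i^{n,w}]_i`, the proximal problem for
`max {f_{i,n,w}, ft}` is solved, and the new model is the affine function through the optimum. -/
def SubalgStep (n w : ℕ) (i : V) : Prop :=
  ∃ (s xp zp : Euc m) (ft φ : Euc m → ℝ),
    let p : Euc m := (P.xbar - T.vH n w - T.z n w (.inl i)) i
    let c : Euc m := T.centre n w i
    IsSubgradientAt (P.f i) s p ∧
    (∀ x, ft x = (P.f i p).toReal + ⟪s, x - p⟫_ℝ) ∧
    (∀ x, φ x = max (T.fm n w i x) (ft x)) ∧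
    IsProxPrimalSol c (fun x => (φ x : EReal)) xp ∧
    IsProxDualSol c (fun x => (φ x : EReal)) zp ∧
    (∀ x, T.fm n (w + 1) i x = φ xp + ⟪x - xp, c - xp⟫_ℝ) ∧
    (∀ j, j ≠ i → T.z n (w + 1) (.inl i) j = 0) ∧
    T.z n (w + 1) (.inl i) i = zp

/-- The objective of the block minimization over `{z_α}_{α ∈ S_{n,w}}`. -/
def blockObj (n w : ℕ) (y : DualIdx P.G m → ProdSpace V m) : EReal :=
  (((1 / 2 : ℝ) * ‖P.xbar - ∑ a, y a‖ ^ 2 : ℝ) : EReal)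
    + ∑ a ∈ T.S n w, fenchelConj (T.bigFm n w a) (y a)

/-- `{z_α^{n,w+1}}_{α ∈ S_{n,w+1}}` minimizes the block objective, the other dual variables being
fixed at their values `z_α^{n,w}`. -/
def BlockMinStep (n w : ℕ) : Prop :=
  ∀ y : DualIdx P.G m → ProdSpace V m, (∀ a, a ∉ T.S n (w + 1) → y a = T.z n w a) →
    T.blockObj n (w + 1) (T.z n (w + 1)) ≤ T.blockObj n (w + 1) y

/-- `T` is generated by the distributed Dykstra algorithm. -/
structure IsRun : Prop where
  wbar_pos : 0 < T.wbar
  Creg_pos : 0 < T.Creg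
  /- initialization -/
  init_node : ∀ i j, j ≠ i → T.z 1 0 (.inl i) j = 0
  init_model_convex : ∀ i, P.cls i = .V₄ → ConvexOn ℝ Set.univ (T.fm 1 0 i)
  init_model_le : ∀ i, P.cls i = .V₄ → ∀ x, (T.fm 1 0 i x : EReal) ≤ P.f i x
  /- the choice of `Ē_n` and the redistribution of the edge variables
     (for `n = 1` these say in particular that `v_H^{1,0} ∈ D^⊥`) -/
  connects : ∀ n, 1 ≤ n → ConnectsV (T.Ebar n)
  edge_zero : ∀ n, 1 ≤ n → ∀ a, a ∉ T.Ebar n → T.z n 0 (.inr a) = 0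
  edge_mem : ∀ n, 1 ≤ n → ∀ a, T.z n 0 (.inr a) ∈ (edgeSubspace a)ᗮ
  edge_norm : ∀ n, 1 ≤ n → ∀ a, ‖T.z n 0 (.inr a)‖ ≤ T.Creg * ‖T.vH n 0‖
  /- the inner loop -/
  S_nonempty : ∀ n w, 1 ≤ n → 1 ≤ w → w ≤ T.wbar → (T.S n w).Nonempty
  S_edges : ∀ n w, 1 ≤ n → 1 ≤ w → w ≤ T.wbar → ∀ a, Sum.inr a ∈ T.S n w → a ∈ T.Ebar n
  subalg : ∀ n w, 1 ≤ n → w < T.wbar → T.StepInV4 n (w + 1) →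
    ∀ i, Sum.inl i ∈ T.S n (w + 1) → T.SubalgStep n w i
  subalg_other : ∀ n w, 1 ≤ n → w < T.wbar → T.StepInV4 n (w + 1) →
    ∀ i, P.cls i = .V₄ → Sum.inl i ∉ T.S n (w + 1) → T.fm n (w + 1) i = T.fm n w i
  block_model : ∀ n w, 1 ≤ n → w < T.wbar → ¬ T.StepInV4 n (w + 1) →
    ∀ i, P.cls i = .V₄ → T.fm n (w + 1) i = T.fm n w i
  block_min : ∀ n w, 1 ≤ n → w < T.wbar → ¬ T.StepInV4 n (w + 1) → T.BlockMinStep n w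
  keep : ∀ n w, 1 ≤ n → w < T.wbar → ∀ a, a ∉ T.S n (w + 1) → T.z n (w + 1) a = T.z n w a
  /- passing to the next outer iteration -/
  next_node : ∀ n, 1 ≤ n → ∀ i, T.z (n + 1) 0 (.inl i) = T.z n T.wbar (.inl i)
  next_edge : ∀ n, 1 ≤ n → T.vH (n + 1) 0 = T.vH n T.wbar
  next_model : ∀ n, 1 ≤ n → ∀ i, P.cls i = .V₄ → T.fm (n + 1) 0 i = T.fm n T.wbar i

/-- `p(n,α)`, the last inner step of iteration `n` in which `α` is active. -/
def lastActive (n : ℕ) (a : DualIdx P.G m) : ℕ :=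
  sSup {w | 1 ≤ w ∧ w ≤ T.wbar ∧ a ∈ T.S n w}

/-- The standing assumptions on the schedule. -/
structure StandingAssumptions : Prop where
  /-- `Ē_n = [⋃_w S_{n,w}] ∩ Ē` -/
  edges_used : ∀ n, 1 ≤ n → ∀ a, a ∈ T.Ebar n →
    ∃ w, 1 ≤ w ∧ w ≤ T.wbar ∧ Sum.inr a ∈ T.S n w
  /-- `V ⊆ ⋃_w S_{n,w}` -/
  nodes_used : ∀ n, 1 ≤ n → ∀ i, ∃ w, 1 ≤ w ∧ w ≤ T.wbar ∧ Sum.inl i ∈ T.S n w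
  /-- when the subalgorithm is called in a step `w + 1 > 1`, each `[z_i^{n,w}]_i`, `i ∈ V₄`, is
  optimal for the current model -/
  start_optimal : ∀ n w, 1 ≤ n → 1 ≤ w → w < T.wbar → T.StepInV4 n (w + 1) →
    ∀ i, P.cls i = .V₄ →
      IsProxDualSol (T.centre n w i) (fun x => (T.fm n w i x : EReal)) (T.z n w (.inl i) i)
  /-- after its last activation in iteration `n`, a node of `V₄` is not touched by the edges -/
  untouched : ∀ n, 1 ≤ n → ∀ i, P.cls i = .V₄ →
    ∀ w, T.lastActive n (.inl i) < w → w ≤ T.wbar → ∀ a, Sum.inr a ∈ T.S n w →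
      ∀ v ∈ (edgeSubspace a)ᗮ, v i = 0
  /-- `S_{n,1} = V₄` for `n > 1` (no condition if `V₄` is empty) -/
  first_step : (∃ i, P.cls i = .V₄) → ∀ n, 1 < n →
    ∀ a, a ∈ T.S n 1 ↔ ∃ i, a = .inl i ∧ P.cls i = .V₄

end Trace

end DistProblem

end

/-! Let the cost be the negative of the dual objective for the current models, up to the constant
½‖x̄‖². Every inner step lowers it by at least half the squared displacement of the primal iterate
x̄ - ∑ z_α (`progress`). For a block minimization this comes from the curvature of the quadratic
term, and for the subalgorithm from `prox_progress`. If D is the decrease over one outer iteration,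
all primal iterates inside it therefore lie within O(√D) of each other.

At the end of an outer iteration every node and every edge of Ē_n has been active. The iterate at
its last activation is a subgradient of its conjugate at its current dual variable. Convexity then
bounds the dual gap by inner products of displacements with differences of bounded dual variables,
once the edge part has been redistributed over Ē_n (`gap_le`). For a node of V₄ the model is only a
minorant of f_i, which leaves an error. The first step of the next outer iteration adds the
linearization of f_i at exactly the point where this error is measured, so a large error forces
large progress there (`prox_gap`). With h the dual gap this gives h(n+1) ≤ A√(2(h(n) - h(n+1))) +
A'(δ + A''√(2δ)), where δ = h(n+1) - h(n+2). Squaring and telescoping bounds n·h(n)², which is a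
rate n^(-1/2), stronger than needed (`exists_rate_of_recursion`).

The constants are uniform because superlevel sets of F are bounded in the node variables and in the
sum of the edge variables (`exists_bound_of_le_dualObj`). The duality gap splits into nonnegative
terms, and the constraint qualification excludes directions of recession. The same bound gives
boundedness of the node iterates and, by compactness, a dual optimizer. -/

/-! ### Conjugates in the extended reals and the variational inequality for block minimizers. -/

section ConjugateCalculus

variable {H : Type*} [NormedAddCommGroup H] [InnerProductSpace ℝ H]

/-- Testing against real points of the epigraph removes the extended-real subtraction, so later
convexity arguments are inequalities between real numbers. -/
theorem fenchelConj_le_coe_iff {f : H → EReal} {z : H} {r : ℝ} :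
    fenchelConj f z ≤ (r : EReal) ↔ ∀ x (t : ℝ), f x ≤ (t : EReal) → ⟪z, x⟫_ℝ ≤ r + t := by
  unfold fenchelConj
  rw [iSup_le_iff]
  refine forall_congr' fun x => ?_
  induction hfx : f x with
  | bot =>
    refine iff_of_false ?_ fun h => ?_
    · simp
    · have := h (⟪z, x⟫_ℝ - r - 1) bot_le
      linarith
  | top => simp
  | coe a =>
    constructor
    · intro h t ht
      have h1 : ⟪z, x⟫_ℝ - a ≤ r := by exact_mod_cast h
      have h2 : a ≤ t := by exact_mod_cast ht
      linarith
    · intro h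
      have h1 := h a le_rfl
      have : ⟪z, x⟫_ℝ - a ≤ r := by linarith
      exact_mod_cast this

theorem fenchelConj_ne_bot {f : H → EReal} {x : H} (hx : f x ≠ ⊤) (z : H) :
    fenchelConj f z ≠ ⊥ := by
  intro h
  have h1 : fenchelConj f z ≤ ((0 : ℝ) : EReal) := by rw [h]; exact bot_le
  have h2 : (((⟪z, x⟫_ℝ : ℝ) : EReal) - f x) ≤ fenchelConj f z :=
    le_iSup (fun x : H => ((⟪z, x⟫_ℝ : ℝ) : EReal) - f x) x
  rw [h, le_bot_iff] at h2
  induction hfx : f x with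
  | bot => simp [hfx] at h2
  | top => exact hx hfx
  | coe a =>
    rw [hfx, ← EReal.coe_sub] at h2
    exact EReal.coe_ne_bot _ h2

theorem fenchelConj_anti {f g : H → EReal} (h : ∀ x, f x ≤ g x) (z : H) :
    fenchelConj g z ≤ fenchelConj f z :=
  iSup_mono fun x => EReal.sub_le_sub le_rfl (h x)

theorem fenchelConj_convex {f : H → EReal} {y z : H} {p q t : ℝ} (ht0 : 0 ≤ t) (ht1 : t ≤ 1)
    (hz : fenchelConj f z ≤ (p : EReal)) (hy : fenchelConj f y ≤ (q : EReal)) :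
    fenchelConj f (z + t • (y - z)) ≤ (((1 - t) * p + t * q : ℝ) : EReal) := by
  rw [fenchelConj_le_coe_iff] at *
  intro x s hs
  have h1 := hz x s hs
  have h2 := hy x s hs
  rw [inner_add_left, inner_smul_left, inner_sub_left]
  simp only [conj_trivial]
  nlinarith

theorem lowerSemicontinuous_fenchelConj (f : H → EReal) :
    LowerSemicontinuous (fenchelConj f) := by
  unfold fenchelConj
  refine lowerSemicontinuous_iSup fun x => ?_
  induction hfx : f x with
  | bot =>
    simpa using (continuous_const (y := (⊤ : EReal)) (X := H)).lowerSemicontinuous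
  | top =>
    simpa using (continuous_const (y := (⊥ : EReal)) (X := H)).lowerSemicontinuous
  | coe a =>
    have : Continuous fun z : H => ((⟪z, x⟫_ℝ - a : ℝ) : EReal) :=
      continuous_coe_real_ereal.comp (by fun_prop)
    simpa using this.lowerSemicontinuous

/-- First-order optimality for ½‖·‖² plus a convex function: the derivative along the segment at t =
0 cannot be negative. It serves both block minimizers and proximal points. -/
theorem add_inner_le_of_forall_segment {a d : H} {p q : ℝ}
    (h : ∀ t : ℝ, 0 < t → t ≤ 1 →
      1 / 2 * ‖a‖ ^ 2 + p ≤ 1 / 2 * ‖a - t • d‖ ^ 2 + ((1 - t) * p + t * q)) :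
    p + ⟪a, d⟫_ℝ ≤ q := by
  by_contra! hlt
  set e := p + ⟪a, d⟫_ℝ - q with he
  have he0 : 0 < e := by rw [he]; linarith
  have hd : 0 < ‖d‖ ^ 2 + 1 := by positivity
  -- With e the assumed violation, this t makes the quadratic term t²‖d‖²/2 too small to compensate
  -- for the linear loss t·e.
  have ht0 : 0 < min 1 (e / (‖d‖ ^ 2 + 1)) := lt_min one_pos (div_pos he0 hd)
  have ht1 := min_le_left 1 (e / (‖d‖ ^ 2 + 1))
  have ht2 := min_le_right 1 (e / (‖d‖ ^ 2 + 1))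
  set t := min 1 (e / (‖d‖ ^ 2 + 1))
  have h1 := h t ht0 ht1
  rw [norm_sub_sq_real, inner_smul_right, norm_smul, Real.norm_of_nonneg ht0.le] at h1
  have h2 : t * (‖d‖ ^ 2 + 1) ≤ e := (le_div_iff₀ hd).1 ht2
  have h3 : t * e ≤ t * (1 / 2 * (t * ‖d‖ ^ 2)) := by rw [he]; nlinarith
  have h4 := le_of_mul_le_mul_left h3 ht0
  nlinarith [sq_nonneg ‖d‖]

theorem EReal.coe_sum_real {ι : Type*} (s : Finset ι) (f : ι → ℝ) :
    ((∑ i ∈ s, f i : ℝ) : EReal) = ∑ i ∈ s, (f i : EReal) := by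
  classical
  induction s using Finset.induction_on with
  | empty => simp
  | insert a s ha ih => rw [Finset.sum_insert ha, Finset.sum_insert ha, EReal.coe_add, ih]

theorem EReal.sum_ne_bot {ι : Type*} {s : Finset ι} {f : ι → EReal} (h : ∀ i ∈ s, f i ≠ ⊥) :
    ∑ i ∈ s, f i ≠ ⊥ := by
  classical
  induction s using Finset.induction_on with
  | empty => simp
  | insert a s ha ih =>
    rw [Finset.sum_insert ha, EReal.add_ne_bot_iff]
    exact ⟨h a (by simp), ih fun i hi => h i (by simp [hi])⟩

theorem EReal.ne_top_of_sum_ne_top {ι : Type*} {s : Finset ι} {f : ι → EReal}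
    (h : ∀ i ∈ s, f i ≠ ⊥) (hs : ∑ i ∈ s, f i ≠ ⊤) : ∀ i ∈ s, f i ≠ ⊤ := by
  classical
  induction s using Finset.induction_on with
  | empty => simp
  | insert a s ha ih =>
    rw [Finset.sum_insert ha, EReal.add_ne_top_iff_ne_top₂ (h a (by simp))
      (EReal.sum_ne_bot fun i hi => h i (by simp [hi]))] at hs
    intro i hi
    rcases Finset.mem_insert.1 hi with rfl | hi
    · exact hs.1
    · exact ih (fun i hi => h i (by simp [hi])) hs.2 i hi

theorem EReal.exists_coe_eq {x : EReal} (h : x ≠ ⊥) (h' : x ≠ ⊤) : ∃ r : ℝ, x = (r : EReal) :=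
  ⟨x.toReal, (EReal.coe_toReal h' h).symm⟩

theorem sum_add_smul_sub {ι : Type*} [Fintype ι] (z y : ι → H) (t : ℝ) :
    ∑ a, (z a + t • (y a - z a)) = ∑ a, z a + t • (∑ a, y a - ∑ a, z a) := by
  rw [Finset.sum_add_distrib, ← Finset.smul_sum, Finset.sum_sub_distrib]

/-- A competitor with all conjugates finite has finite objective, so the minimizer cannot use the
value ⊤. -/
theorem block_ne_top {ι : Type*} [Fintype ι] {φ : ι → H → EReal} {S : Finset ι} {b : H}
    {z : ι → H} (hdom : ∀ a ∈ S, ∃ x, φ a x ≠ ⊤)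
    (hconj : ∀ a ∈ S, ∃ y, fenchelConj (φ a) y ≠ ⊤)
    (hmin : ∀ y : ι → H, (∀ a, a ∉ S → y a = z a) →
      (((1 / 2 : ℝ) * ‖b - ∑ a, z a‖ ^ 2 : ℝ) : EReal) + ∑ a ∈ S, fenchelConj (φ a) (z a) ≤
      (((1 / 2 : ℝ) * ‖b - ∑ a, y a‖ ^ 2 : ℝ) : EReal) + ∑ a ∈ S, fenchelConj (φ a) (y a)) :
    ∀ a ∈ S, fenchelConj (φ a) (z a) ≠ ⊤ := by
  classical
  have hbot : ∀ a ∈ S, ∀ y, fenchelConj (φ a) y ≠ ⊥ := fun a ha y =>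
    let ⟨x, hx⟩ := hdom a ha
    fenchelConj_ne_bot hx y
  choose! y hy using hconj
  have h := hmin (fun a => if a ∈ S then y a else z a) fun a ha => by simp [ha]
  have hr : ∑ a ∈ S, fenchelConj (φ a) (if a ∈ S then y a else z a) =
      ((∑ a ∈ S, (fenchelConj (φ a) (y a)).toReal : ℝ) : EReal) := by
    rw [EReal.coe_sum_real]
    refine Finset.sum_congr rfl fun a ha => ?_
    rw [if_pos ha, EReal.coe_toReal (hy a ha) (hbot a ha _)]
  refine EReal.ne_top_of_sum_ne_top (fun a ha => hbot a ha _) fun htop => ?_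
  rw [htop, hr, ← EReal.coe_add, EReal.coe_add_top, top_le_iff] at h
  exact EReal.coe_ne_top _ h

/-- The residual b - ∑ z acts as a joint subgradient of the active conjugates. This is
`add_inner_le_of_forall_segment` along the segment from z to y. -/
theorem block_variational {ι : Type*} [Fintype ι] {φ : ι → H → EReal} {S : Finset ι} {b : H}
    {z y : ι → H} {p q : ι → ℝ}
    (hmin : ∀ y : ι → H, (∀ a, a ∉ S → y a = z a) →
      (((1 / 2 : ℝ) * ‖b - ∑ a, z a‖ ^ 2 : ℝ) : EReal) + ∑ a ∈ S, fenchelConj (φ a) (z a) ≤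
      (((1 / 2 : ℝ) * ‖b - ∑ a, y a‖ ^ 2 : ℝ) : EReal) + ∑ a ∈ S, fenchelConj (φ a) (y a))
    (hz : ∀ a ∈ S, fenchelConj (φ a) (z a) = (p a : EReal))
    (hy : ∀ a ∈ S, fenchelConj (φ a) (y a) ≤ (q a : EReal))
    (hoff : ∀ a, a ∉ S → y a = z a) :
    ∑ a ∈ S, p a + ⟪b - ∑ a, z a, ∑ a, y a - ∑ a, z a⟫_ℝ ≤ ∑ a ∈ S, q a := by
  refine add_inner_le_of_forall_segment fun t ht0 ht1 => ?_
  have h := hmin (fun a => z a + t • (y a - z a)) fun a ha => by simp [hoff a ha]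
  have h2 : ∑ a ∈ S, fenchelConj (φ a) (z a + t • (y a - z a)) ≤
      ((∑ a ∈ S, ((1 - t) * p a + t * q a) : ℝ) : EReal) := by
    rw [EReal.coe_sum_real]
    exact Finset.sum_le_sum fun a ha =>
      fenchelConj_convex ht0.le ht1 (hz a ha).le (hy a ha)
  have h3 := h.trans (add_le_add_right h2 _)
  rw [Finset.sum_congr rfl hz, ← EReal.coe_sum_real, ← EReal.coe_add, ← EReal.coe_add,
    EReal.coe_le_coe_iff, sum_add_smul_sub, Finset.sum_add_distrib, ← Finset.mul_sum,
    ← Finset.mul_sum, ← sub_sub] at h3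
  exact h3

end ConjugateCalculus

/-! ### Affine minorants and conjugates of subspace indicators. -/

section Duality

variable {H : Type*} [NormedAddCommGroup H] [InnerProductSpace ℝ H]

/-- The strict epigraph is open because f is continuous in finite dimension. A hyperplane separating
it from (x₀, f x₀) is not vertical, since a point directly above x₀ lies strictly on one side. -/
theorem exists_subgradient_of_convexOn [FiniteDimensional ℝ H] {f : H → ℝ}
    (hf : ConvexOn ℝ Set.univ f) (x₀ : H) :
    ∃ g : H, ∀ x, f x₀ + ⟪g, x - x₀⟫_ℝ ≤ f x := by
  have hc : Continuous f := by
    have := hf.continuousOn_interior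
    rwa [interior_univ, continuousOn_univ] at this
  have hconv : Convex ℝ {p : H × ℝ | p.1 ∈ Set.univ ∧ f p.1 < p.2} := hf.convex_strict_epigraph
  have hopen : IsOpen {p : H × ℝ | p.1 ∈ Set.univ ∧ f p.1 < p.2} := by
    simp only [Set.mem_univ, true_and]
    exact isOpen_lt (hc.comp continuous_fst) continuous_snd
  obtain ⟨L, hL⟩ := geometric_hahn_banach_open_point hconv hopen
    (x := (x₀, f x₀)) (by simp)
  have hdec : ∀ x t, L (x, t) = L (x, 0) + t * L (0, 1) := by
    intro x t
    have : ((x, t) : H × ℝ) = (x, 0) + t • (0, 1) := by simp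
    rw [this, map_add, map_smul, smul_eq_mul]
  set b := L (0, 1) with hb
  have hb0 : b < 0 := by
    have := hL (x₀, f x₀ + 1) (by simp)
    rw [hdec x₀ (f x₀ + 1), hdec x₀ (f x₀)] at this
    linarith
  have hle : ∀ x, L (x, 0) + f x * b ≤ L (x₀, 0) + f x₀ * b := by
    intro x
    refine le_of_forall_pos_le_add fun ε hε => ?_
    have := hL (x, f x + ε / (-b)) (by simpa using div_pos hε (neg_pos.2 hb0))
    rw [hdec x (f x + _), hdec x₀ (f x₀)] at this
    have h1 : (f x + ε / (-b)) * b = f x * b - ε := by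
      field_simp [hb0.ne]
      ring
    linarith
  let l : H →L[ℝ] ℝ := (-b)⁻¹ • (L.comp (ContinuousLinearMap.inl ℝ H ℝ))
  have : CompleteSpace H := FiniteDimensional.complete ℝ H
  refine ⟨(InnerProductSpace.toDual ℝ H).symm l, fun x => ?_⟩
  rw [InnerProductSpace.toDual_symm_apply]
  have hl : l (x - x₀) = (-b)⁻¹ * (L (x, 0) - L (x₀, 0)) := by
    have : ((x - x₀, 0) : H × ℝ) = (x, 0) - (x₀, 0) := by simp
    simp only [l, smul_apply, ContinuousLinearMap.comp_apply,
      ContinuousLinearMap.inl_apply, smul_eq_mul]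
    rw [this, map_sub]
  rw [hl]
  have h1 := hle x
  have h2 : (-b)⁻¹ * (L (x, 0) - L (x₀, 0)) ≤ (-b)⁻¹ * ((-b) * (f x - f x₀)) :=
    mul_le_mul_of_nonneg_left (by linarith) (inv_nonneg.2 (by linarith))
  rw [← mul_assoc, inv_mul_cancel₀ (by linarith), one_mul] at h2
  linarith

/-- Separating a point strictly below the graph from the closed epigraph gives an affine minorant,
whose slope has finite conjugate. -/
theorem IsClosedConvex.exists_fenchelConj_ne_top [CompleteSpace H] {f : H → EReal}
    (hf : IsClosedConvex f) {x₀ : H} (hx₀ : f x₀ ≠ ⊤) : ∃ z, fenchelConj f z ≠ ⊤ := by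
  obtain ⟨a, ha⟩ := EReal.exists_coe_eq (hf.ne_bot x₀) hx₀
  have hcl : IsClosed {p : H × ℝ | f p.1 ≤ (p.2 : EReal)} := by
    have h := hf.lsc.isClosed_epigraph
    exact h.preimage (f := fun p : H × ℝ => (p.1, (p.2 : EReal)))
      (continuous_fst.prodMk (continuous_coe_real_ereal.comp continuous_snd))
  obtain ⟨L, u, hL, hu⟩ := geometric_hahn_banach_point_closed hf.convex_epi hcl
    (x := (x₀, a - 1)) (by
      simp only [Set.mem_ofPred_eq, ha, EReal.coe_le_coe_iff]; linarith)
  have hdec : ∀ x t, L (x, t) = L (x, 0) + t * L (0, 1) := by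
    intro x t
    have : ((x, t) : H × ℝ) = (x, 0) + t • (0, 1) := by simp
    rw [this, map_add, map_smul, smul_eq_mul]
  set b := L (0, 1) with hb
  have hb0 : 0 < b := by
    have := hu (x₀, a) (by simp [ha])
    rw [hdec x₀ a] at this
    rw [hdec x₀ (a - 1)] at hL
    linarith
  let l : H →L[ℝ] ℝ := (-b⁻¹) • (L.comp (ContinuousLinearMap.inl ℝ H ℝ))
  refine ⟨(InnerProductSpace.toDual ℝ H).symm l, ne_top_of_le_ne_top
    (EReal.coe_ne_top (-b⁻¹ * u)) ?_⟩
  rw [fenchelConj_le_coe_iff]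
  intro x t ht
  rw [InnerProductSpace.toDual_symm_apply]
  have h1 := hu (x, t) ht
  rw [hdec x t] at h1
  simp only [l, smul_apply, ContinuousLinearMap.comp_apply,
      ContinuousLinearMap.inl_apply, smul_eq_mul]
  have h2 : b⁻¹ * u ≤ b⁻¹ * (L (x, 0) + t * b) :=
    mul_le_mul_of_nonneg_left h1.le (inv_nonneg.2 hb0.le)
  have h3 : b⁻¹ * (L (x, 0) + t * b) = b⁻¹ * L (x, 0) + t := by
    field_simp
  linarith

theorem exists_fenchelConj_ne_top_of_convexOn [FiniteDimensional ℝ H] {f : H → ℝ}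
    (hf : ConvexOn ℝ Set.univ f) : ∃ z, fenchelConj (fun x => (f x : EReal)) z ≠ ⊤ := by
  obtain ⟨g, hg⟩ := exists_subgradient_of_convexOn hf 0
  refine ⟨g, ne_top_of_le_ne_top (EReal.coe_ne_top (-f 0)) ?_⟩
  rw [fenchelConj_le_coe_iff]
  intro x t ht
  have h1 := hg x
  rw [EReal.coe_le_coe_iff] at ht
  rw [sub_zero] at h1
  linarith

theorem fenchelConj_indicator_submodule (K : Submodule ℝ H) {z : H} (hz : z ∈ Kᗮ) :
    fenchelConj (indicatorFun (K : Set H)) z = 0 := by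
  refine le_antisymm ?_ ?_
  · rw [← EReal.coe_zero, fenchelConj_le_coe_iff]
    intro x t ht
    by_cases hx : x ∈ K
    · have h0 : (0 : EReal) ≤ (t : EReal) := by simpa [indicatorFun, hx] using ht
      have h1 : (0 : ℝ) ≤ t := by exact_mod_cast h0
      rw [(Submodule.mem_orthogonal' K z).1 hz x hx]
      linarith
    · simp [indicatorFun, hx] at ht
  · exact le_iSup_of_le 0 (by simp [indicatorFun])

/-- A linear functional bounded above on a subspace vanishes there. -/
theorem mem_orthogonal_of_fenchelConj_indicator_ne_top (K : Submodule ℝ H) {z : H}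
    (hz : fenchelConj (indicatorFun (K : Set H)) z ≠ ⊤) : z ∈ Kᗮ := by
  have hbot : fenchelConj (indicatorFun (K : Set H)) z ≠ ⊥ :=
    fenchelConj_ne_bot (x := 0) (by simp [indicatorFun]) z
  obtain ⟨r, hr⟩ := EReal.exists_coe_eq hbot hz
  have h := fenchelConj_le_coe_iff.1 hr.le
  rw [Submodule.mem_orthogonal']
  intro x hx
  have hk : ∀ c : ℝ, c * ⟪z, x⟫_ℝ ≤ r := by
    intro c
    have := h (c • x) 0 (by simp [indicatorFun, K.smul_mem c hx])
    rw [inner_smul_right] at this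
    linarith
  by_contra hne
  have := hk ((r + 1) / ⟪z, x⟫_ℝ)
  rw [div_mul_cancel₀ _ hne] at this
  linarith

end Duality

/-! ### Proximal steps and compactness bounds. -/

section Bounds

open Filter Topology

variable {H : Type*} [NormedAddCommGroup H] [InnerProductSpace ℝ H]

/-- `u` is a subgradient of the conjugate `φ*` at `z`, and `φ*(z)` is finite. -/
def IsConjSubgradient (φ : H → EReal) (z u : H) : Prop :=
  ∃ p : ℝ, fenchelConj φ z = (p : EReal) ∧
    ∀ y (r : ℝ), fenchelConj φ y ≤ (r : EReal) → p + ⟪u, y - z⟫_ℝ ≤ r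

theorem prox_subgradient {φ : H → ℝ} (hφ : ConvexOn ℝ Set.univ φ) {c xp : H}
    (h : IsProxPrimalSol c (fun x => (φ x : EReal)) xp) (x : H) :
    φ xp + ⟪c - xp, x - xp⟫_ℝ ≤ φ x := by
  refine add_inner_le_of_forall_segment fun t ht0 ht1 => ?_
  have h1 := h (xp + t • (x - xp))
  simp only [proxObj] at h1
  rw [← EReal.coe_add, ← EReal.coe_add, EReal.coe_le_coe_iff, ← sub_sub] at h1
  have h2 := hφ.2 (Set.mem_univ xp) (Set.mem_univ x) (by linarith : 0 ≤ 1 - t) ht0.le (by ring)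
  have h3 : (1 - t) • xp + t • x = xp + t • (x - xp) := by
    rw [sub_smul, one_smul, smul_sub]; abel
  rw [h3, smul_eq_mul, smul_eq_mul] at h2
  linarith

theorem fenchelConj_affine (a : ℝ) (x₀ g : H) :
    fenchelConj (fun x => ((a + ⟪x - x₀, g⟫_ℝ : ℝ) : EReal)) g = ((⟪g, x₀⟫_ℝ - a : ℝ) : EReal) := by
  refine le_antisymm ?_ ?_
  · rw [fenchelConj_le_coe_iff]
    intro x t ht
    rw [EReal.coe_le_coe_iff, inner_sub_left, real_inner_comm g x, real_inner_comm g x₀] at ht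
    linarith
  · refine le_iSup_of_le x₀ ?_
    simp

/-- If the slopes differ, moving along y - g makes the supremum infinite. -/
theorem eq_of_fenchelConj_affine_ne_top {a : ℝ} {x₀ g y : H}
    (h : fenchelConj (fun x => ((a + ⟪x - x₀, g⟫_ℝ : ℝ) : EReal)) y ≠ ⊤) : y = g := by
  obtain ⟨r, hr⟩ := EReal.exists_coe_eq
    (fenchelConj_ne_bot (f := fun x => ((a + ⟪x - x₀, g⟫_ℝ : ℝ) : EReal)) (x := 0)
      (EReal.coe_ne_top _) y) h
  have h1 := fenchelConj_le_coe_iff.1 hr.le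
  rw [← sub_eq_zero, ← norm_eq_zero]
  by_contra hne
  have hpos : 0 < ‖y - g‖ ^ 2 := by positivity
  -- This step length violates the conjugate inequality by exactly 1.
  set k := (r + a + 1 - ⟪y, x₀⟫_ℝ) / ‖y - g‖ ^ 2 with hk
  have h2 := h1 (x₀ + k • (y - g)) _ le_rfl
  have h3 : k * ‖y - g‖ ^ 2 = r + a + 1 - ⟪y, x₀⟫_ℝ := div_mul_cancel₀ _ hpos.ne'
  have h4 : ‖y - g‖ ^ 2 = ⟪y, y - g⟫_ℝ - ⟪y - g, g⟫_ℝ := by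
    rw [← real_inner_self_eq_norm_sq, inner_sub_left, real_inner_comm (y - g) g]
  rw [add_sub_cancel_left, inner_add_right, inner_smul_right, inner_smul_left] at h2
  simp only [conj_trivial] at h2
  rw [h4] at h3
  linarith

/-- Moreau decomposition: c - xp is feasible with equality in Fenchel–Young at xp. Comparing values
with zp leaves only the square ‖c - xp - zp‖². -/
theorem prox_dual_eq {φ : H → ℝ} (hφ : ConvexOn ℝ Set.univ φ) {c xp zp : H}
    (h : IsProxPrimalSol c (fun x => (φ x : EReal)) xp)
    (hd : IsProxDualSol c (fun x => (φ x : EReal)) zp) : zp = c - xp := by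
  have hsub := prox_subgradient hφ h
  have hg : fenchelConj (fun x => (φ x : EReal)) (c - xp) ≤
      ((⟪c - xp, xp⟫_ℝ - φ xp : ℝ) : EReal) := by
    rw [fenchelConj_le_coe_iff]
    intro x t ht
    rw [EReal.coe_le_coe_iff] at ht
    have := hsub x
    rw [inner_sub_right] at this
    linarith
  have h1 := (hd (c - xp)).trans (add_le_add_right hg _)
  have h2 : ((⟪zp, xp⟫_ℝ - φ xp : ℝ) : EReal) ≤ fenchelConj (fun x => (φ x : EReal)) zp :=
    le_iSup_of_le xp (by simp)
  have h3 := (add_le_add_right h2 _).trans h1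
  rw [← EReal.coe_add, ← EReal.coe_add, EReal.coe_le_coe_iff] at h3
  have h4 : ‖c - zp‖ ^ 2 = ‖xp‖ ^ 2 + 2 * ⟪xp, c - xp - zp⟫_ℝ + ‖c - xp - zp‖ ^ 2 := by
    rw [← norm_add_sq_real]; congr 2; abel
  have h5 : c - (c - xp) = xp := by abel
  rw [h5, h4, inner_sub_right, real_inner_comm (c - xp) xp, real_inner_comm zp xp] at h3
  have h6 : ‖c - xp - zp‖ ^ 2 ≤ 0 := by linarith
  have h7 : c - xp - zp = 0 := by
    rw [← norm_eq_zero]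
    exact pow_eq_zero_iff (two_ne_zero) |>.1 (le_antisymm h6 (sq_nonneg _))
  rw [sub_eq_zero] at h7
  exact h7.symm

/-- Here g is the new dual variable and z the old one, with old conjugate value r. Fenchel–Young for
the old model at xp, and the domination of the old model by the new one there, suffice; z need not
be optimal for the old model. -/
theorem prox_progress {c z g xp : H} {r φxp f₀ : ℝ} (hg : g = c - xp)
    (hr : ⟪z, xp⟫_ℝ ≤ r + f₀) (hle : f₀ ≤ φxp) :
    1 / 2 * ‖z - g‖ ^ 2 + (1 / 2 * ‖c - g‖ ^ 2 + (⟪g, xp⟫_ℝ - φxp)) ≤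
      1 / 2 * ‖c - z‖ ^ 2 + r := by
  have h5 : c - g = xp := by rw [hg]; abel
  have h4 : ‖c - z‖ ^ 2 = ‖xp‖ ^ 2 - 2 * ⟪xp, z - g⟫_ℝ + ‖z - g‖ ^ 2 := by
    rw [← norm_sub_sq_real, ← h5]; congr 2; abel
  rw [h5, h4, inner_sub_right, real_inner_comm z xp, real_inner_comm g xp]
  linarith

/-- The step moves the primal point from p to xp = p + (z - g), a distance at most √(2D). The new
model lies above the linearization at p, so an underestimate at p must show up in the decrease D, up
to the slope mismatch s - z. -/
theorem prox_gap {c z g xp p s : H} {r φxp f₀ fp D : ℝ} (hg : g = c - xp) (hp : p = c - z)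
    (hr : f₀ = ⟪z, p⟫_ℝ - r) (hs : fp + ⟪s, xp - p⟫_ℝ ≤ φxp)
    (hz : 1 / 2 * ‖z - g‖ ^ 2 ≤ D)
    (hD : 1 / 2 * ‖c - g‖ ^ 2 + (⟪g, xp⟫_ℝ - φxp) + D = 1 / 2 * ‖c - z‖ ^ 2 + r) :
    fp - f₀ ≤ D + ‖s - z‖ * √(2 * D) := by
  have h1 : ‖z - g‖ ≤ √(2 * D) := Real.le_sqrt_of_sq_le (by linarith)
  have h2 : xp = p + (z - g) := by rw [hg, hp]; abel
  have h3 : -(‖s - z‖ * √(2 * D)) ≤ ⟪s - z, z - g⟫_ℝ :=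
    (neg_le_neg (mul_le_mul_of_nonneg_left h1 (norm_nonneg _))).trans
      (neg_le_of_abs_le (abs_real_inner_le_norm _ _))
  have h5 : c - g = p + (z - g) := by rw [hp]; abel
  rw [h5, ← hp, norm_add_sq_real, h2] at hD
  rw [h2, add_sub_cancel_left] at hs
  have h6 : ⟪g, p + (z - g)⟫_ℝ = ⟪z, p⟫_ℝ + ⟪z, z - g⟫_ℝ - ⟪p, z - g⟫_ℝ - ‖z - g‖ ^ 2 := by
    rw [← real_inner_self_eq_norm_sq, real_inner_comm (z - g) p]
    have : g = z - (z - g) := by abel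
    conv_lhs => rw [this]
    rw [inner_sub_left, inner_add_right, inner_add_right]
    ring_nf
    simp
    ring
  rw [h6] at hD
  rw [inner_sub_left] at h3
  nlinarith [sq_nonneg ‖z - g‖]

/-- f is bounded on the ball of radius R + 1, and a unit step from p in the direction of s raises f
by at least ‖s‖. -/
theorem exists_bound_subgradient [FiniteDimensional ℝ H] {f : H → ℝ}
    (hf : ConvexOn ℝ Set.univ f) (R : ℝ) :
    ∃ L : ℝ, ∀ p s : H, ‖p‖ ≤ R → (∀ x, f p + ⟪s, x - p⟫_ℝ ≤ f x) → ‖s‖ ≤ L := by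
  have hc : Continuous f := by
    have := hf.continuousOn_interior
    rwa [interior_univ, continuousOn_univ] at this
  have := FiniteDimensional.proper ℝ H
  obtain ⟨M, hM⟩ := (isCompact_closedBall (0 : H) (R + 1)).exists_bound_of_continuousOn
    hc.continuousOn
  refine ⟨2 * M, fun p s hp hs => ?_⟩
  have hp1 := hM p (by simpa using hp.trans (by linarith))
  by_cases h0 : s = 0
  · have := norm_nonneg (f p)
    rw [h0, norm_zero]
    linarith
  have hn : 0 < ‖s‖ := norm_pos_iff.2 h0
  have hx1 := hM (p + ‖s‖⁻¹ • s) (by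
    rw [mem_closedBall_zero_iff]
    refine (norm_add_le _ _).trans ?_
    rw [norm_smul, norm_inv, norm_norm, inv_mul_cancel₀ hn.ne']
    linarith)
  have h1 := hs (p + ‖s‖⁻¹ • s)
  rw [add_sub_cancel_left, inner_smul_right, real_inner_self_eq_norm_sq, pow_two, ← mul_assoc,
    inv_mul_cancel₀ hn.ne', one_mul] at h1
  have h2 := abs_le.1 hp1
  have h3 := abs_le.1 hx1
  linarith [h2.1, h3.2]

/-- If the bound fails, normalize an unbounded sequence and pass to a limit on the unit sphere. The
constants M i + t and B₁ are divided away, so the limit is a nonzero vector that the qualification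
forbids. -/
theorem exists_bound_of_qualification [FiniteDimensional ℝ H] {V : Type*} [Fintype V]
    (f : V → H → EReal) (x : H)
    (hQ : ∀ y : V → H, (∀ i c (t : ℝ), f i c ≤ (t : EReal) → ⟪y i, c - x⟫_ℝ ≤ 0) →
      ∑ i, y i = 0 → y = 0) (M : V → ℝ) (B₁ : ℝ) :
    ∃ B : ℝ, ∀ y : V → H,
      (∀ i c (t : ℝ), f i c ≤ (t : EReal) → ⟪y i, c - x⟫_ℝ ≤ M i + t) → ‖∑ i, y i‖ ≤ B₁ →
      ‖y‖ ≤ B := by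
  by_contra! hcon
  choose y hy hsum hlt using fun n : ℕ => hcon (n + 1)
  have hpos : ∀ n, 0 < ‖y n‖ := fun n => lt_trans (by positivity) (hlt n)
  have hinv : Tendsto (fun n => ‖y n‖⁻¹) atTop (𝓝 0) := by
    refine tendsto_inv_atTop_zero.comp (tendsto_atTop_mono (fun n => (hlt n).le) ?_)
    exact tendsto_atTop_add_const_right _ _ tendsto_natCast_atTop_atTop
  have := FiniteDimensional.proper ℝ (V → H)
  obtain ⟨u, hu, φ, hφ, hlim⟩ := (isCompact_sphere (0 : V → H) 1).tendsto_subseq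
    (x := fun n => ‖y n‖⁻¹ • y n) (fun n => by
      rw [mem_sphere_zero_iff_norm, norm_smul, norm_inv, norm_norm, inv_mul_cancel₀ (hpos n).ne'])
  have hinv' := hinv.comp hφ.tendsto_atTop
  have hcoord : ∀ i, Tendsto (fun n => ‖y (φ n)‖⁻¹ • y (φ n) i) atTop (𝓝 (u i)) := fun i =>
    (tendsto_pi_nhds.1 hlim) i
  have hu0 : u = 0 := by
    refine hQ u (fun i c t ht => ?_) ?_
    · have h1 : Tendsto (fun n => ⟪‖y (φ n)‖⁻¹ • y (φ n) i, c - x⟫_ℝ) atTop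
          (𝓝 ⟪u i, c - x⟫_ℝ) := (hcoord i).inner tendsto_const_nhds
      have h2 : Tendsto (fun n => ‖y (φ n)‖⁻¹ * (M i + t)) atTop (𝓝 (0 * (M i + t))) :=
        hinv'.mul_const _
      rw [zero_mul] at h2
      refine le_of_tendsto_of_tendsto' h1 h2 fun n => ?_
      rw [inner_smul_left]
      exact mul_le_mul_of_nonneg_left (hy _ i c t ht) (inv_nonneg.2 (norm_nonneg _))
    · have h1 : Tendsto (fun n => ‖∑ i, ‖y (φ n)‖⁻¹ • y (φ n) i‖) atTop (𝓝 ‖∑ i, u i‖) :=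
        (tendsto_finsetSum _ fun i _ => hcoord i).norm
      have h2 : Tendsto (fun n => ‖y (φ n)‖⁻¹ * B₁) atTop (𝓝 (0 * B₁)) := hinv'.mul_const _
      rw [zero_mul] at h2
      rw [← norm_le_zero_iff]
      refine le_of_tendsto_of_tendsto' h1 h2 fun n => ?_
      rw [← Finset.smul_sum, norm_smul, norm_inv, norm_norm]
      exact mul_le_mul_of_nonneg_left (hsum _) (inv_nonneg.2 (norm_nonneg _))
  rw [hu0] at hu
  simp at hu

/-- The summation map from the product of the W a onto its range has a linear right inverse, which
is continuous in finite dimension; κ is its norm. -/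
theorem exists_bounded_decomposition [FiniteDimensional ℝ H] {ι : Type*} [Fintype ι]
    (W : ι → Submodule ℝ H) :
    ∃ κ : ℝ, 0 ≤ κ ∧ ∀ u ∈ ⨆ a, W a, ∃ g : ι → H, (∀ a, g a ∈ W a) ∧ ∑ a, g a = u ∧
      ∀ a, ‖g a‖ ≤ κ * ‖u‖ := by
  classical
  let Λ : (∀ a, W a) →ₗ[ℝ] H := ∑ a, (W a).subtype ∘ₗ LinearMap.proj a
  have hΛ : ∀ g, Λ g = ∑ a, (g a : H) := fun g => by simp [Λ]
  have hle : ⨆ a, W a ≤ LinearMap.range Λ := by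
    refine iSup_le fun a x hx => ⟨Pi.single a ⟨x, hx⟩, ?_⟩
    rw [hΛ, Finset.sum_eq_single a]
    · simp
    · intro b _ hb; simp [hb]
    · simp
  obtain ⟨R, hR⟩ := LinearMap.exists_rightInverse_of_surjective Λ.rangeRestrict
    (LinearMap.range_rangeRestrict Λ)
  let R' := LinearMap.toContinuousLinearMap R
  refine ⟨‖R'‖, R'.opNorm_nonneg, fun u hu => ?_⟩
  have hu' := hle hu
  refine ⟨fun a => (R ⟨u, hu'⟩ a : H), fun a => (R ⟨u, hu'⟩ a).2, ?_, fun a => ?_⟩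
  · rw [← hΛ]
    have := congrArg Subtype.val (LinearMap.congr_fun hR ⟨u, hu'⟩)
    simpa using this
  · exact (norm_le_pi_norm (R ⟨u, hu'⟩) a).trans (R'.le_opNorm ⟨u, hu'⟩)

/-- In finite dimension the orthogonal complement of an intersection is the sum of the complements.
This turns the connectivity of an edge set into a decomposition over its edges. -/
theorem exists_bounded_decomposition_orthogonal [FiniteDimensional ℝ H] {ι : Type*} [Fintype ι]
    (K : ι → Submodule ℝ H) (E : Set ι) :
    ∃ κ : ℝ, 0 ≤ κ ∧ ∀ u ∈ (⨅ a ∈ E, K a)ᗮ, ∃ g : ι → H, (∀ a, g a ∈ (K a)ᗮ) ∧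
      (∀ a, a ∉ E → g a = 0) ∧ ∑ a, g a = u ∧ ∀ a, ‖g a‖ ≤ κ * ‖u‖ := by
  obtain ⟨κ, hκ, h⟩ := exists_bounded_decomposition fun a => ⨆ _ : a ∈ E, (K a)ᗮ
  refine ⟨κ, hκ, fun u hu => ?_⟩
  have heq : (⨅ a ∈ E, K a)ᗮ = ⨆ a, ⨆ _ : a ∈ E, (K a)ᗮ := by
    have h1 : (⨆ a, ⨆ _ : a ∈ E, (K a)ᗮ)ᗮ = ⨅ a ∈ E, K a := by
      rw [← Submodule.iInf_orthogonal]
      refine iInf_congr fun a => ?_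
      by_cases ha : a ∈ E <;> simp [ha]
    rw [← h1, Submodule.orthogonal_orthogonal]
  obtain ⟨g, hg, hsum, hn⟩ := h u (heq ▸ hu)
  refine ⟨g, fun a => ?_, fun a ha => ?_, hsum, hn⟩
  · by_cases ha : a ∈ E
    · simpa [ha] using hg a
    · have := hg a
      simp only [ha, iSup_false, Submodule.mem_bot] at this
      rw [this]
      exact Submodule.zero_mem _
  · have := hg a
    simpa [ha] using this

end Bounds

/-! ### Vectors supported on one block. -/

section Blocks

variable {V : Type*} {m : ℕ}

open Classical in
/-- The element of `𝐗` whose `i`-th block is `y` and whose other blocks vanish. -/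
noncomputable def blockVec (i : V) (y : Euc m) : ProdSpace V m :=
  WithLp.toLp 2 (Pi.single i y)

@[simp] theorem blockVec_same (i : V) (y : Euc m) : blockVec i y i = y := by simp [blockVec]

theorem blockVec_of_ne {i j : V} (h : j ≠ i) (y : Euc m) : blockVec i y j = 0 := by
  simp [blockVec, h]

/-- The element of `𝐗` all of whose blocks are `x`. -/
noncomputable def constVec (x : Euc m) : ProdSpace V m := WithLp.toLp 2 fun _ => x

@[simp] theorem constVec_apply (x : Euc m) (i : V) : constVec x i = x := rfl

theorem constVec_mem {G : SimpleGraph V} (x : Euc m) (a : EdgeIdx G m) :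
    (constVec x : ProdSpace V m) ∈ edgeSubspace a := by
  intro i _ j _
  simp

theorem eq_blockVec {z : ProdSpace V m} {i : V} (hz : ∀ j, j ≠ i → z j = 0) :
    z = blockVec i (z i) := by
  refine PiLp.ext fun j => ?_
  by_cases h : j = i
  · rw [h, blockVec_same]
  · rw [hz j h, blockVec_of_ne h]

variable [Fintype V]

theorem inner_eq_of_block {z : ProdSpace V m} {i : V} (hz : ∀ j, j ≠ i → z j = 0)
    (x : ProdSpace V m) : ⟪z, x⟫_ℝ = ⟪z i, x i⟫_ℝ := by
  rw [PiLp.inner_apply, Finset.sum_eq_single i]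
  · intro j _ hj
    rw [hz j hj, inner_zero_left]
  · simp

theorem norm_eq_of_block {z : ProdSpace V m} {i : V} (hz : ∀ j, j ≠ i → z j = 0) :
    ‖z‖ = ‖z i‖ := by
  have h := inner_eq_of_block hz z
  rw [real_inner_self_eq_norm_sq, real_inner_self_eq_norm_sq] at h
  exact (sq_eq_sq₀ (norm_nonneg _) (norm_nonneg _)).1 h

theorem inner_blockVec (i : V) (y : Euc m) (x : ProdSpace V m) :
    ⟪blockVec i y, x⟫_ℝ = ⟪y, x i⟫_ℝ := by
  rw [inner_eq_of_block (fun j hj => blockVec_of_ne hj y), blockVec_same]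

theorem fenchelConj_liftFun {i : V} {φ : Euc m → EReal} {z : ProdSpace V m}
    (hz : ∀ j, j ≠ i → z j = 0) : fenchelConj (liftFun i φ) z = fenchelConj φ (z i) := by
  unfold fenchelConj liftFun
  simp_rw [inner_eq_of_block hz]
  have hs : Function.Surjective fun x : ProdSpace V m => x i := fun y => ⟨constVec y, by simp⟩
  exact hs.iSup_comp fun x : Euc m => ((⟪z i, x⟫_ℝ : ℝ) : EReal) - φ x

/-- Moving in a block j ≠ i does not change φ but changes the linear term without bound unless z j =
0. -/
theorem block_of_fenchelConj_liftFun_ne_top {i : V} {φ : Euc m → EReal} {x₀ : Euc m}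
    (hb : φ x₀ ≠ ⊥) (ht : φ x₀ ≠ ⊤) {z : ProdSpace V m} (h : fenchelConj (liftFun i φ) z ≠ ⊤) :
    ∀ j, j ≠ i → z j = 0 := by
  intro j hj
  obtain ⟨t, ht'⟩ := EReal.exists_coe_eq hb ht
  obtain ⟨r, hr⟩ := EReal.exists_coe_eq
    (fenchelConj_ne_bot (f := liftFun i φ) (x := constVec x₀) (by simpa [liftFun] using ht) z) h
  have h1 := fenchelConj_le_coe_iff.1 hr.le
  by_contra hne
  have hpos : 0 < ‖z j‖ ^ 2 := by
    have := norm_pos_iff.2 hne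
    positivity
  set k := (r + t + 1 - ⟪z, constVec x₀⟫_ℝ) / ‖z j‖ ^ 2 with hk
  have h2 := h1 (constVec x₀ + k • blockVec j (z j)) t (by
    simp [liftFun, blockVec_of_ne hj.symm, ht'])
  have h3 : k * ‖z j‖ ^ 2 = r + t + 1 - ⟪z, constVec x₀⟫_ℝ := div_mul_cancel₀ _ hpos.ne'
  rw [inner_add_right, inner_smul_right, real_inner_comm, real_inner_comm (blockVec j (z j)),
    inner_blockVec, real_inner_self_eq_norm_sq, real_inner_comm z] at h2
  linarith

end Blocks

/-! ### Dual level sets and existence of a dual optimizer. -/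

namespace DistProblem

variable {V : Type*} [Fintype V] {m : ℕ} (P : DistProblem V m)

theorem exists_bigF_ne_top (a : DualIdx P.G m) : ∃ x, P.bigF a x ≠ ⊤ := by
  obtain ⟨x, hx⟩ := P.feasible
  refine ⟨constVec x, ?_⟩
  cases a with
  | inl i => exact hx i
  | inr a =>
    have : (constVec x : ProdSpace V m) ∈ edgeSubspace a := constVec_mem x a
    simp [bigF, indicatorFun, this]

theorem exists_fenchelConj_bigF_ne_top (a : DualIdx P.G m) :
    ∃ z, fenchelConj (P.bigF a) z ≠ ⊤ := by
  cases a with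
  | inl i =>
    obtain ⟨x, hx⟩ := P.feasible
    obtain ⟨y, hy⟩ := (P.closedConvex i).exists_fenchelConj_ne_top (hx i)
    refine ⟨blockVec i y, ?_⟩
    rw [bigF, fenchelConj_liftFun (fun j hj => blockVec_of_ne hj y), blockVec_same]
    exact hy
  | inr a =>
    refine ⟨0, ?_⟩
    rw [bigF, fenchelConj_indicator_submodule _ (Submodule.zero_mem _)]
    exact EReal.zero_ne_top

theorem block_of_fenchelConj_bigF_ne_top {i : V} {z : ProdSpace V m}
    (h : fenchelConj (P.bigF (.inl i)) z ≠ ⊤) : ∀ j, j ≠ i → z j = 0 := by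
  obtain ⟨x, hx⟩ := P.feasible
  exact block_of_fenchelConj_liftFun_ne_top ((P.closedConvex i).ne_bot x) (hx i) h

variable {P}

theorem dualObj_eq_coe {φ : DualIdx P.G m → ProdSpace V m → EReal}
    {z : DualIdx P.G m → ProdSpace V m} {r : DualIdx P.G m → ℝ}
    (h : ∀ a, fenchelConj (φ a) (z a) = (r a : EReal)) :
    P.dualObj φ z = ((-(1 / 2 : ℝ) * ‖P.xbar - ∑ a, z a‖ ^ 2 + (1 / 2 : ℝ) * ‖P.xbar‖ ^ 2
      - ∑ a, r a : ℝ) : EReal) := by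
  rw [dualObj, EReal.coe_sub, EReal.coe_sum_real]
  simp_rw [h]

theorem exists_conj_of_dualObj_ne_bot {φ : DualIdx P.G m → ProdSpace V m → EReal}
    {z : DualIdx P.G m → ProdSpace V m} (hφ : ∀ a, ∃ x, φ a x ≠ ⊤)
    (h : P.dualObj φ z ≠ ⊥) :
    ∃ r : DualIdx P.G m → ℝ, ∀ a, fenchelConj (φ a) (z a) = (r a : EReal) := by
  have hb : ∀ a, fenchelConj (φ a) (z a) ≠ ⊥ := fun a =>
    let ⟨x, hx⟩ := hφ a
    fenchelConj_ne_bot hx _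
  have ht : ∀ a ∈ Finset.univ, fenchelConj (φ a) (z a) ≠ ⊤ := by
    refine EReal.ne_top_of_sum_ne_top (fun a _ => hb a) fun htop => h ?_
    rw [dualObj, htop, EReal.sub_top]
  exact ⟨fun a => (fenchelConj (φ a) (z a)).toReal, fun a =>
    (EReal.coe_toReal (ht a (Finset.mem_univ a)) (hb a)).symm⟩

theorem dualObj_ne_top {φ : DualIdx P.G m → ProdSpace V m → EReal}
    (z : DualIdx P.G m → ProdSpace V m) (hφ : ∀ a, ∃ x, φ a x ≠ ⊤) : P.dualObj φ z ≠ ⊤ := by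
  intro h
  obtain ⟨r, hr⟩ := exists_conj_of_dualObj_ne_bot hφ (by rw [h]; exact top_ne_bot)
  rw [dualObj_eq_coe hr] at h
  exact EReal.coe_ne_top _ h

theorem dualObj_mono {φ ψ : DualIdx P.G m → ProdSpace V m → EReal}
    (h : ∀ a x, φ a x ≤ ψ a x) (z : DualIdx P.G m → ProdSpace V m) :
    P.dualObj φ z ≤ P.dualObj ψ z :=
  EReal.sub_le_sub le_rfl (Finset.sum_le_sum fun a _ => fenchelConj_anti (h a) _)

theorem edge_mem_of_conj_bigF {a : EdgeIdx P.G m} {z : ProdSpace V m} {r : ℝ}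
    (h : fenchelConj (P.bigF (.inr a)) z = (r : EReal)) : z ∈ (edgeSubspace a)ᗮ ∧ r = 0 := by
  have h1 : z ∈ (edgeSubspace a)ᗮ := mem_orthogonal_of_fenchelConj_indicator_ne_top _ (by
    change fenchelConj (P.bigF (.inr a)) z ≠ ⊤
    rw [h]
    exact EReal.coe_ne_top _)
  refine ⟨h1, ?_⟩
  have h2 : fenchelConj (P.bigF (.inr a)) z = 0 := fenchelConj_indicator_submodule _ h1
  rw [h] at h2
  exact_mod_cast h2

theorem inner_edge_sum_constVec {y : EdgeIdx P.G m → ProdSpace V m}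
    (hy : ∀ a, y a ∈ (edgeSubspace a)ᗮ) (x : Euc m) : ⟪∑ a, y a, constVec x⟫_ℝ = 0 := by
  rw [sum_inner]
  exact Finset.sum_eq_zero fun a _ =>
    (Submodule.mem_orthogonal' _ _).1 (hy a) _ (constVec_mem x a)

theorem inner_sum_constVec {y : DualIdx P.G m → ProdSpace V m}
    (hn : ∀ i j, j ≠ i → y (.inl i) j = 0) (hy : ∀ a, y (.inr a) ∈ (edgeSubspace a)ᗮ)
    (x : Euc m) : ⟪∑ a, y a, constVec x⟫_ℝ = ⟪∑ i, y (.inl i) i, x⟫_ℝ := by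
  rw [Fintype.sum_sum_type, inner_add_left, inner_edge_sum_constVec hy, add_zero, sum_inner,
    sum_inner]
  exact Finset.sum_congr rfl fun i _ => inner_eq_of_block (hn i) _

/-- The duality gap at `x` and `y`, as a sum of nonnegative terms. -/
theorem duality_gap {y : DualIdx P.G m → ProdSpace V m} {r : DualIdx P.G m → ℝ}
    (hr : ∀ a, fenchelConj (P.bigF a) (y a) = (r a : EReal)) (x : Euc m) (t : V → ℝ) :
    -(1 / 2 : ℝ) * ‖P.xbar - ∑ a, y a‖ ^ 2 + (1 / 2 : ℝ) * ‖P.xbar‖ ^ 2 - ∑ a, r a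
      + 1 / 2 * ‖P.xbar - ∑ a, y a - constVec x‖ ^ 2
      + ∑ i, (r (.inl i) + t i - ⟪y (.inl i) i, x⟫_ℝ)
      = 1 / 2 * ‖P.xbar - constVec x‖ ^ 2 + ∑ i, t i := by
  have hn : ∀ i j, j ≠ i → y (.inl i) j = 0 := fun i =>
    P.block_of_fenchelConj_bigF_ne_top (by rw [hr]; exact EReal.coe_ne_top _)
  have he : ∀ a, y (.inr a) ∈ (edgeSubspace a)ᗮ := fun a => (edge_mem_of_conj_bigF (hr _)).1
  -- Edge variables are orthogonal to the diagonal, so only the node variables pair with `constVec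
  -- x`.
  have h1 := (inner_sum_constVec hn he x).trans (sum_inner _ _ _)
  have h2 : ∑ a, r a = ∑ i, r (.inl i) := by
    rw [Fintype.sum_sum_type, add_eq_left]
    exact Finset.sum_eq_zero fun a _ => (edge_mem_of_conj_bigF (hr _)).2
  rw [norm_sub_sq_real (P.xbar - ∑ a, y a), norm_sub_sq_real P.xbar (constVec x),
    inner_sub_left, h1, h2, Finset.sum_sub_distrib, Finset.sum_add_distrib]
  ring

theorem f_ne_top_of_isPrimalMinimizer {x : Euc m} (hx : P.IsPrimalMinimizer x) (i : V) :
    P.f i x ≠ ⊤ := by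
  obtain ⟨y, hy⟩ := P.feasible
  have hy' : P.primalObj y ≠ ⊤ := by
    have : ∀ i, ∃ t : ℝ, P.f i y = (t : EReal) := fun i =>
      EReal.exists_coe_eq ((P.closedConvex i).ne_bot y) (hy i)
    choose t ht using this
    rw [primalObj]
    simp_rw [ht, ← EReal.coe_add]
    rw [← EReal.coe_sum_real]
    exact EReal.coe_ne_top _
  have hx' := ne_top_of_le_ne_top hy' (hx y)
  have hb : ∀ i, P.f i x ≠ ⊥ := fun i => (P.closedConvex i).ne_bot x
  have h := EReal.ne_top_of_sum_ne_top (s := Finset.univ) (fun i _ =>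
    EReal.add_ne_bot_iff.2 ⟨EReal.coe_ne_bot _, hb i⟩) hx' i (Finset.mem_univ i)
  exact ((EReal.add_ne_top_iff_ne_top₂ (EReal.coe_ne_bot _) (hb i)).1 h).2

/-- Outside V₁ ∪ V₂ the domain is the whole space and its normal cone is trivial, so the
qualification extends to all nodes. Passing to the closure of the domain costs nothing, as
half-spaces are closed. -/
theorem eq_zero_of_constraintQualification {x : Euc m} (hx : ∀ i, P.f i x ≠ ⊤)
    (hCQ : P.ConstraintQualification x) (y : V → Euc m)
    (hy : ∀ i c (t : ℝ), P.f i c ≤ (t : EReal) → ⟪y i, c - x⟫_ℝ ≤ 0) (hsum : ∑ i, y i = 0) :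
    y = 0 := by
  classical
  have hdom : ∀ i, ∀ c ∈ effDom (P.f i), ⟪y i, c - x⟫_ℝ ≤ 0 := fun i c hc =>
    hy i c _ (EReal.coe_toReal hc ((P.closedConvex i).ne_bot c)).ge
  have huniv : ∀ i, effDom (P.f i) = Set.univ → y i = 0 := by
    intro i hi
    have := hdom i (x + y i) (by rw [hi]; trivial)
    rw [add_sub_cancel_left, real_inner_self_eq_norm_sq] at this
    rw [← norm_eq_zero]
    exact pow_eq_zero_iff (two_ne_zero) |>.1 (le_antisymm this (sq_nonneg _))
  have hother : ∀ i, ¬ (P.cls i = .V₁ ∨ P.cls i = .V₂) → y i = 0 := by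
    intro i hi
    refine huniv i ?_
    cases h : P.cls i with
    | V₁ => exact absurd (Or.inl h) hi
    | V₂ => exact absurd (Or.inr h) hi
    | V₃ => exact P.cls_three i h
    | V₄ => exact P.cls_four i h
  funext i
  by_cases hi : P.cls i = .V₁ ∨ P.cls i = .V₂
  · refine hCQ y (fun i _ => ⟨subset_closure (hx i), ?_⟩) ?_ i hi
    · have hcl : IsClosed {c : Euc m | ⟪y i, c - x⟫_ℝ ≤ 0} :=
        isClosed_le (by fun_prop) continuous_const
      exact fun c hc => closure_minimal (hdom i) hcl hc
    · exact (Finset.sum_filter_of_ne fun j _ hj => by_contra fun h => hj (hother j h)).trans hsum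
  · exact hother i hi

/-- In `duality_gap` every term is nonnegative, so a lower bound on F(y) bounds each of them: the
square controls ∑ y_a, and the Fenchel–Young slacks give the hypothesis of
`exists_bound_of_qualification`. Only the sum of the edge variables is bounded, since F depends on
them only through that sum. -/
theorem exists_bound_of_le_dualObj {x : Euc m} (hx : ∀ i, P.f i x ≠ ⊤)
    (hCQ : P.ConstraintQualification x) (M : ℝ) :
    ∃ B : ℝ, ∀ y : DualIdx P.G m → ProdSpace V m, (M : EReal) ≤ P.dualObj P.bigF y →
      (∀ i, ‖y (.inl i)‖ ≤ B) ∧ ‖∑ a, y a‖ ≤ B ∧ ‖∑ a, y (.inr a)‖ ≤ B := by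
  have : ∀ i, ∃ t : ℝ, P.f i x = (t : EReal) := fun i =>
    EReal.exists_coe_eq ((P.closedConvex i).ne_bot x) (hx i)
  choose t ht using this
  set M' := 1 / 2 * ‖P.xbar - constVec x‖ ^ 2 + ∑ i, t i - M with hM'
  set B₁ := ‖P.xbar - constVec x‖ + √(2 * M') with hB₁
  have hone : ∃ κ : ℝ, 0 ≤ κ ∧ ∀ u : ProdSpace V m, ‖∑ i, u i‖ ≤ κ * ‖u‖ := by
    let Λ : ProdSpace V m →L[ℝ] Euc m :=
      ∑ i, PiLp.proj (𝕜 := ℝ) 2 (fun _ : V => Euc m) i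
    refine ⟨‖Λ‖, Λ.opNorm_nonneg, fun u => ?_⟩
    have := Λ.le_opNorm u
    simpa [Λ, sum_apply] using this
  obtain ⟨κ, hκ, hκ'⟩ := hone
  obtain ⟨B₂, hB₂⟩ := exists_bound_of_qualification P.f x
    (eq_zero_of_constraintQualification hx hCQ) (fun i => M' - t i) (κ * B₁)
  refine ⟨max (max B₁ B₂) (B₁ + Fintype.card V * B₂), fun y hy => ?_⟩
  obtain ⟨r, hr⟩ := exists_conj_of_dualObj_ne_bot P.exists_bigF_ne_top
    (ne_bot_of_le_ne_bot (EReal.coe_ne_bot M) hy)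
  rw [dualObj_eq_coe hr, EReal.coe_le_coe_iff] at hy
  have hgap := duality_gap hr x t
  have hn : ∀ i j, j ≠ i → y (.inl i) j = 0 := fun i =>
    P.block_of_fenchelConj_bigF_ne_top (by rw [hr]; exact EReal.coe_ne_top _)
  have he : ∀ a, y (.inr a) ∈ (edgeSubspace a)ᗮ := fun a => (edge_mem_of_conj_bigF (hr _)).1
  have hf : ∀ i, fenchelConj (P.f i) (y (.inl i) i) = (r (.inl i) : EReal) := fun i => by
    rw [← fenchelConj_liftFun (hn i)]
    exact hr (.inl i)
  have hnonneg : ∀ i, 0 ≤ r (.inl i) + t i - ⟪y (.inl i) i, x⟫_ℝ := fun i => by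
    have := fenchelConj_le_coe_iff.1 (hf i).le x (t i) (ht i).le
    linarith
  have hsum := Finset.sum_nonneg fun i (_ : i ∈ Finset.univ) => hnonneg i
  have hv : ‖P.xbar - ∑ a, y a - constVec x‖ ≤ √(2 * M') := Real.le_sqrt_of_sq_le (by linarith)
  have hv1 : ‖∑ a, y a‖ ≤ B₁ := by
    have : ∑ a, y a = (P.xbar - constVec x) - (P.xbar - ∑ a, y a - constVec x) := by abel
    rw [this]
    exact (norm_sub_le _ _).trans (add_le_add_right hv _)
  -- Summing blocks is pairing with constant vectors, which annihilates the edge part.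
  have hblocks : ∑ i, (∑ a, y a) i = ∑ i, y (.inl i) i := by
    refine ext_inner_right ℝ fun c => ?_
    rw [← inner_sum_constVec hn he c]
    exact (sum_inner _ _ _).trans (by rw [PiLp.inner_apply]; rfl)
  have hnodes : ‖fun i => y (.inl i) i‖ ≤ B₂ := by
    refine hB₂ (fun i => y (.inl i) i) (fun i c s hs => ?_) ?_
    · have h1 := fenchelConj_le_coe_iff.1 (hf i).le c s hs
      have h2 : r (.inl i) + t i - ⟪y (.inl i) i, x⟫_ℝ ≤ M' := by
        refine (Finset.single_le_sum (fun i _ => hnonneg i) (Finset.mem_univ i)).trans ?_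
        have := sq_nonneg ‖P.xbar - ∑ a, y a - constVec x‖
        linarith
      rw [inner_sub_right]
      linarith
    · rw [← hblocks]
      exact (hκ' _).trans (mul_le_mul_of_nonneg_left hv1 hκ)
  have hnode : ∀ i, ‖y (.inl i)‖ ≤ B₂ := fun i => by
    rw [norm_eq_of_block (hn i)]
    exact (norm_le_pi_norm (fun i => y (.inl i) i) i).trans hnodes
  refine ⟨fun i => (hnode i).trans ((le_max_right _ _).trans (le_max_left _ _)),
    hv1.trans ((le_max_left _ _).trans (le_max_left _ _)), le_trans ?_ (le_max_right _ _)⟩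
  have : ∑ a, y (.inr a) = ∑ a, y a - ∑ i, y (.inl i) := by
    rw [Fintype.sum_sum_type]; abel
  rw [this]
  refine (norm_sub_le _ _).trans (add_le_add hv1 ?_)
  refine (norm_sum_le _ _).trans ((Finset.sum_le_sum fun i _ => hnode i).trans ?_)
  simp

/-- Continuity of extended-real addition at the relevant points needs conjugates that never equal ⊥,
which is what `hφ` provides. -/
theorem lowerSemicontinuous_sum_conj (φ : DualIdx P.G m → ProdSpace V m → EReal)
    (hφ : ∀ a, ∃ x, φ a x ≠ ⊤) :
    LowerSemicontinuous fun y : DualIdx P.G m → ProdSpace V m =>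
      ((1 / 2 * ‖P.xbar - ∑ a, y a‖ ^ 2 : ℝ) : EReal) + ∑ a, fenchelConj (φ a) (y a) := by
  classical
  have hb : ∀ a y, fenchelConj (φ a) y ≠ ⊥ := fun a y =>
    let ⟨x, hx⟩ := hφ a
    fenchelConj_ne_bot hx _
  have hsum : ∀ s : Finset (DualIdx P.G m),
      LowerSemicontinuous fun y : DualIdx P.G m → ProdSpace V m =>
        ∑ a ∈ s, fenchelConj (φ a) (y a) := by
    intro s
    induction s using Finset.induction_on with
    | empty => simpa using continuous_const.lowerSemicontinuous
    | insert a s ha ih =>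
      simp_rw [Finset.sum_insert ha]
      refine LowerSemicontinuous.add' ?_ ih fun y => ?_
      · exact (lowerSemicontinuous_fenchelConj (φ a)).comp (continuous_apply a)
      · exact EReal.continuousAt_add (Or.inr (EReal.sum_ne_bot fun a _ => hb a _))
          (Or.inl (hb a _))
  refine LowerSemicontinuous.add' ?_ (hsum _) fun y => ?_
  · refine Continuous.lowerSemicontinuous (continuous_coe_real_ereal.comp ?_)
    fun_prop
  · exact EReal.continuousAt_add (Or.inl (EReal.coe_ne_top _)) (Or.inl (EReal.coe_ne_bot _))

/-- Redistributing the edge variables boundedly without changing their sum leaves F unchanged. The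
problem thus reduces to a semicontinuous function on a compact ball. -/
theorem exists_isDualOptimizer {x : Euc m} (hx : ∀ i, P.f i x ≠ ⊤)
    (hCQ : P.ConstraintQualification x) {y₀ : DualIdx P.G m → ProdSpace V m}
    (hy₀ : P.dualObj P.bigF y₀ ≠ ⊥) : ∃ z, P.IsDualOptimizer z := by
  obtain ⟨M, hM⟩ := EReal.exists_coe_eq hy₀ (dualObj_ne_top y₀ P.exists_bigF_ne_top)
  obtain ⟨B, hB⟩ := exists_bound_of_le_dualObj hx hCQ M
  obtain ⟨κ, hκ, hdec⟩ := exists_bounded_decomposition_orthogonal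
    (fun a : EdgeIdx P.G m => edgeSubspace a) Set.univ
  have hR0 : 0 ≤ B := (norm_nonneg _).trans (hB y₀ hM.ge).2.1
  set R := max B (κ * B) with hR
  have hgood : ∀ y, (M : EReal) ≤ P.dualObj P.bigF y →
      ∃ y' ∈ Metric.closedBall (0 : DualIdx P.G m → ProdSpace V m) R,
        P.dualObj P.bigF y' = P.dualObj P.bigF y := by
    intro y hy
    obtain ⟨r, hr⟩ := exists_conj_of_dualObj_ne_bot P.exists_bigF_ne_top
      (ne_bot_of_le_ne_bot (EReal.coe_ne_bot M) hy)
    have he : ∀ a, y (.inr a) ∈ (edgeSubspace a)ᗮ := fun a => (edge_mem_of_conj_bigF (hr _)).1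
    have hmem : ∑ a, y (.inr a) ∈ (⨅ a ∈ Set.univ, edgeSubspace a : Submodule ℝ _)ᗮ :=
      Submodule.sum_mem _ fun a _ => Submodule.orthogonal_le (by simpa using iInf_le _ a) (he a)
    obtain ⟨g, hg, -, hsum, hn⟩ := hdec _ hmem
    obtain ⟨hB1, -, hB3⟩ := hB y hy
    refine ⟨Sum.elim (fun i => y (.inl i)) g, ?_, ?_⟩
    · rw [mem_closedBall_zero_iff, pi_norm_le_iff_of_nonneg (hR0.trans (le_max_left _ _))]
      rintro (i | a)
      · exact (hB1 i).trans (le_max_left _ _)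
      · exact (hn a).trans ((mul_le_mul_of_nonneg_left hB3 hκ).trans (le_max_right _ _))
    · have h1 : ∑ a, Sum.elim (fun i => y (.inl i)) g a = ∑ a, y a := by
        rw [Fintype.sum_sum_type, Fintype.sum_sum_type]
        simp [hsum]
      rw [dualObj_eq_coe hr, ← h1]
      refine dualObj_eq_coe ?_
      rintro (i | a)
      · exact hr _
      · rw [(edge_mem_of_conj_bigF (hr (.inr a))).2]
        exact fenchelConj_indicator_submodule _ (hg a)
  obtain ⟨y₁, hy₁, hval⟩ := hgood y₀ hM.ge
  obtain ⟨z, -, hz⟩ := ((lowerSemicontinuous_sum_conj P.bigF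
    P.exists_bigF_ne_top).lowerSemicontinuousOn _).exists_isMinOn ⟨y₁, hy₁⟩
    (isCompact_closedBall (0 : DualIdx P.G m → ProdSpace V m) R)
  have hmax : ∀ y ∈ Metric.closedBall (0 : DualIdx P.G m → ProdSpace V m) R,
      P.dualObj P.bigF y ≤ P.dualObj P.bigF z := by
    intro y hy
    have hle := hz hy
    simp only [Set.mem_ofPred_eq] at hle
    by_cases hbot : P.dualObj P.bigF y = ⊥
    · rw [hbot]; exact bot_le
    obtain ⟨r, hr⟩ := exists_conj_of_dualObj_ne_bot P.exists_bigF_ne_top hbot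
    have hb : ∀ a, fenchelConj (P.bigF a) (z a) ≠ ⊥ := fun a =>
      let ⟨x, hx⟩ := P.exists_bigF_ne_top a
      fenchelConj_ne_bot hx _
    simp_rw [hr] at hle
    rw [← EReal.coe_sum_real, ← EReal.coe_add] at hle
    have htop : ∀ a ∈ Finset.univ, fenchelConj (P.bigF a) (z a) ≠ ⊤ := by
      refine EReal.ne_top_of_sum_ne_top (fun a _ => hb a) fun htop => ?_
      rw [htop, EReal.coe_add_top, top_le_iff] at hle
      exact EReal.coe_ne_top _ hle
    have : ∀ a, ∃ s : ℝ, fenchelConj (P.bigF a) (z a) = (s : EReal) := fun a =>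
      EReal.exists_coe_eq (hb a) (htop a (Finset.mem_univ a))
    choose s hs using this
    simp_rw [hs] at hle
    rw [← EReal.coe_sum_real, ← EReal.coe_add, EReal.coe_le_coe_iff] at hle
    rw [dualObj_eq_coe hr, dualObj_eq_coe hs, EReal.coe_le_coe_iff]
    linarith
  refine ⟨z, fun y => ?_⟩
  by_cases hy : (M : EReal) ≤ P.dualObj P.bigF y
  · obtain ⟨y', hy', h⟩ := hgood y hy
    rw [← h]
    exact hmax y' hy'
  · refine (not_le.1 hy).le.trans ?_
    rw [← hM, ← hval]
    exact hmax y₁ hy₁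

end DistProblem

/-! ### Invariants of the iterates and the form of the new models. -/

namespace DistProblem

namespace Trace

variable {V : Type*} [Fintype V] {m : ℕ} {P : DistProblem V m} (T : P.Trace)

/-- The primal iterate `x̄ - ∑ z_α^{n,w}`. -/
noncomputable def iter (n w : ℕ) : ProdSpace V m := P.xbar - ∑ a, T.z n w a

/-- The value of the conjugate of the current model at the current dual variable. -/
noncomputable def conjVal (n w : ℕ) (a : DualIdx P.G m) : ℝ :=
  (fenchelConj (T.bigFm n w a) (T.z n w a)).toReal

/-- All the conjugates in the dual objective are finite at the current iterate. -/
def IsFinite (n w : ℕ) : Prop := ∀ a, fenchelConj (T.bigFm n w a) (T.z n w a) ≠ ⊤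

/-- The negative of the dual objective, up to the constant `½‖x̄‖²`. -/
noncomputable def cost (n w : ℕ) : ℝ := 1 / 2 * ‖T.iter n w‖ ^ 2 + ∑ a, T.conjVal n w a

/-- Properties of the iterates that are preserved by the algorithm. -/
structure Invariant (n w : ℕ) : Prop where
  node : ∀ i j, j ≠ i → T.z n w (.inl i) j = 0
  edge : ∀ a, T.z n w (.inr a) ∈ (edgeSubspace a)ᗮ
  convex : ∀ i, P.cls i = .V₄ → ConvexOn ℝ Set.univ (T.fm n w i)
  le : ∀ i, P.cls i = .V₄ → ∀ x, (T.fm n w i x : EReal) ≤ P.f i x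

variable {T} {n w : ℕ}

theorem bigFm_model {i : V} (h : P.cls i = .V₄) :
    T.bigFm n w (.inl i) = liftFun i fun x => (T.fm n w i x : EReal) := by
  simp [bigFm, h]

theorem bigFm_node {i : V} (h : P.cls i ≠ .V₄) : T.bigFm n w (.inl i) = P.bigF (.inl i) := by
  simp [bigFm, h]

theorem bigFm_inl_congr {n' w' : ℕ} {i : V}
    (h : P.cls i = .V₄ → T.fm n w i = T.fm n' w' i) :
    T.bigFm n w (.inl i) = T.bigFm n' w' (.inl i) := by
  by_cases hi : P.cls i = .V₄
  · rw [bigFm_model hi, bigFm_model hi, h hi]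
  · rw [bigFm_node hi, bigFm_node hi]

theorem exists_bigFm_ne_top (n w : ℕ) (a : DualIdx P.G m) : ∃ x, T.bigFm n w a x ≠ ⊤ := by
  rcases a with i | a
  · by_cases hi : P.cls i = .V₄
    · rw [bigFm_model hi]
      exact ⟨0, EReal.coe_ne_top _⟩
    · rw [bigFm_node hi]
      exact P.exists_bigF_ne_top _
  · exact P.exists_bigF_ne_top (.inr a)

theorem fenchelConj_bigFm_ne_bot (a : DualIdx P.G m) (z : ProdSpace V m) :
    fenchelConj (T.bigFm n w a) z ≠ ⊥ :=
  let ⟨_, hx⟩ := exists_bigFm_ne_top (T := T) n w a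
  fenchelConj_ne_bot hx _

theorem fenchelConj_eq_conjVal {a : DualIdx P.G m}
    (h : fenchelConj (T.bigFm n w a) (T.z n w a) ≠ ⊤) :
    fenchelConj (T.bigFm n w a) (T.z n w a) = (T.conjVal n w a : EReal) :=
  (EReal.coe_toReal h (fenchelConj_bigFm_ne_bot a _)).symm

theorem dualValue_eq (h : T.IsFinite n w) :
    T.dualValue n w = ((1 / 2 * ‖P.xbar‖ ^ 2 - T.cost n w : ℝ) : EReal) := by
  rw [dualValue, dualObj_eq_coe fun a => fenchelConj_eq_conjVal (h a)]
  simp only [cost, iter]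
  congr 1
  ring

theorem block_of_fenchelConj_bigFm_ne_top {i : V} {z : ProdSpace V m}
    (h : fenchelConj (T.bigFm n w (.inl i)) z ≠ ⊤) : ∀ j, j ≠ i → z j = 0 := by
  by_cases hi : P.cls i = .V₄
  · rw [bigFm_model hi] at h
    exact block_of_fenchelConj_liftFun_ne_top (x₀ := 0) (EReal.coe_ne_bot _) (EReal.coe_ne_top _) h
  · rw [bigFm_node hi] at h
    exact P.block_of_fenchelConj_bigF_ne_top h

namespace Invariant

theorem exists_fenchelConj_ne_top (hI : T.Invariant n w) (a : DualIdx P.G m) :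
    ∃ z, fenchelConj (T.bigFm n w a) z ≠ ⊤ := by
  rcases a with i | a
  · by_cases hi : P.cls i = .V₄
    · obtain ⟨y, hy⟩ := exists_fenchelConj_ne_top_of_convexOn (hI.convex i hi)
      refine ⟨blockVec i y, ?_⟩
      rw [bigFm_model hi, fenchelConj_liftFun (fun j hj => blockVec_of_ne hj y), blockVec_same]
      exact hy
    · rw [bigFm_node hi]
      exact P.exists_fenchelConj_bigF_ne_top _
  · exact P.exists_fenchelConj_bigF_ne_top (.inr a)

theorem bigFm_le (hI : T.Invariant n w) (a : DualIdx P.G m) (x : ProdSpace V m) :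
    T.bigFm n w a x ≤ P.bigF a x := by
  rcases a with i | a
  · by_cases hi : P.cls i = .V₄
    · rw [bigFm_model hi]
      exact hI.le i hi (x i)
    · rw [bigFm_node hi]
  · exact le_rfl

theorem dualValue_le (hI : T.Invariant n w) : T.dualValue n w ≤ P.dualObj P.bigF (T.z n w) :=
  dualObj_mono hI.bigFm_le _

theorem fenchelConj_edge (hI : T.Invariant n w) (a : EdgeIdx P.G m) :
    fenchelConj (T.bigFm n w (.inr a)) (T.z n w (.inr a)) = 0 :=
  fenchelConj_indicator_submodule _ (hI.edge a)

theorem conjVal_edge (hI : T.Invariant n w) (a : EdgeIdx P.G m) : T.conjVal n w (.inr a) = 0 := by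
  rw [conjVal, hI.fenchelConj_edge, EReal.toReal_zero]

theorem iter_apply (hI : T.Invariant n w) (i : V) :
    T.iter n w i = T.centre n w i - T.z n w (.inl i) i := by
  have h1 : (∑ j, T.z n w (.inl j)) i = T.z n w (.inl i) i := by
    rw [WithLp.ofLp_sum, Finset.sum_apply, Finset.sum_eq_single i]
    · exact fun j _ hj => hI.node j i hj.symm
    · simp
  rw [iter, centre, vH, Fintype.sum_sum_type, PiLp.sub_apply, PiLp.sub_apply, PiLp.add_apply, h1]
  abel

/-- For a given v_H the cost is a sum over nodes, so a step inside V₄ can be analysed one node at a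
time. -/
theorem cost_eq (hI : T.Invariant n w) : T.cost n w =
    ∑ i, (1 / 2 * ‖T.centre n w i - T.z n w (.inl i) i‖ ^ 2 + T.conjVal n w (.inl i)) := by
  rw [cost, Fintype.sum_sum_type, Finset.sum_eq_zero (fun a _ => hI.conjVal_edge a), add_zero,
    Finset.sum_add_distrib, ← Finset.mul_sum, PiLp.norm_sq_eq_of_L2]
  simp_rw [hI.iter_apply]

/-- What the subalgorithm at the node `i` produces: the new model is an affine minorant of `f_i`
through `(xp, v)` with slope `[x̄ - v_H]_i - xp`, which is also the new dual variable. -/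
theorem subalg_facts (hI : T.Invariant n w) {i : V} (hi : P.cls i = .V₄)
    (h : T.SubalgStep n w i) :
    ∃ (s xp : Euc m) (v : ℝ),
      IsSubgradientAt (P.f i) s (T.iter n w i) ∧
      T.fm n w i xp ≤ v ∧
      (P.f i (T.iter n w i)).toReal + ⟪s, xp - T.iter n w i⟫_ℝ ≤ v ∧
      (∀ x, ((v + ⟪x - xp, T.centre n w i - xp⟫_ℝ : ℝ) : EReal) ≤ P.f i x) ∧
      T.fm n (w + 1) i = (fun x => v + ⟪x - xp, T.centre n w i - xp⟫_ℝ) ∧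
      (∀ j, j ≠ i → T.z n (w + 1) (.inl i) j = 0) ∧
      T.z n (w + 1) (.inl i) i = T.centre n w i - xp := by
  obtain ⟨s, xp, zp, ft, φ, hs, hft, hφ, hxp, hzp, hfm, hz, hzi⟩ := h
  have hp : (P.xbar - T.vH n w - T.z n w (.inl i)) i = T.iter n w i := by
    rw [hI.iter_apply, PiLp.sub_apply]; rfl
  rw [hp] at hs hft
  have hval : P.f i (T.iter n w i) = ((P.f i (T.iter n w i)).toReal : EReal) :=
    (EReal.coe_toReal hs.1 ((P.closedConvex i).ne_bot _)).symm
  have hftle : ∀ x, (ft x : EReal) ≤ P.f i x := fun x => by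
    have := hs.2 x
    rw [hval, ← EReal.coe_add] at this
    rw [hft]
    exact this
  have hφle : ∀ x, (φ x : EReal) ≤ P.f i x := fun x => by
    rw [hφ]
    rcases max_choice (T.fm n w i x) (ft x) with h | h <;> rw [h]
    exacts [hI.le i hi x, hftle x]
  have hftc : ConvexOn ℝ Set.univ ft := by
    refine ⟨convex_univ, fun x _ y _ a b _ _ hab => le_of_eq ?_⟩
    rw [hft, hft, hft, inner_sub_right, inner_sub_right, inner_sub_right, inner_add_right,
      inner_smul_right, inner_smul_right, smul_eq_mul, smul_eq_mul]
    have : b = 1 - a := by linarith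
    rw [this]
    ring
  have hφc : ConvexOn ℝ Set.univ φ := by
    have : φ = T.fm n w i ⊔ ft := funext fun x => hφ x
    rw [this]
    exact (hI.convex i hi).sup hftc
  refine ⟨s, xp, φ xp, hs, ?_, ?_, fun x => ?_, funext hfm, hz, ?_⟩
  · rw [hφ]; exact le_max_left _ _
  · rw [← hft, hφ]; exact le_max_right _ _
  -- The new model is the tangent to φ at the proximal point, hence below φ, which is below f_i.
  · refine le_trans ?_ (hφle x)
    rw [EReal.coe_le_coe_iff, real_inner_comm]
    exact prox_subgradient hφc hxp x
  · rw [hzi]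
    exact prox_dual_eq hφc hxp hzp

end Invariant

end Trace

end DistProblem

/-! ### Subgradients after a step and decrease of the cost. -/

namespace DistProblem

namespace Trace

variable {V : Type*} [Fintype V] {m : ℕ} {P : DistProblem V m} {T : P.Trace} {n w : ℕ}

theorem fenchelConj_lift_affine {i : V} {v : ℝ} {x₀ g : Euc m} {z : ProdSpace V m}
    (hz : ∀ j, j ≠ i → z j = 0) (hzi : z i = g) :
    fenchelConj (liftFun i fun x => ((v + ⟪x - x₀, g⟫_ℝ : ℝ) : EReal)) z =
      ((⟪g, x₀⟫_ℝ - v : ℝ) : EReal) := by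
  rw [fenchelConj_liftFun hz, hzi, fenchelConj_affine]

/-- The conjugate of an affine function is finite at a single point, so every u qualifies. This lets
the subalgorithm share the treatment of block minimization. -/
theorem isConjSubgradient_lift_affine {i : V} {v : ℝ} {x₀ g : Euc m} {z : ProdSpace V m}
    (hz : ∀ j, j ≠ i → z j = 0) (hzi : z i = g) (u : ProdSpace V m) :
    IsConjSubgradient (liftFun i fun x => ((v + ⟪x - x₀, g⟫_ℝ : ℝ) : EReal)) z u := by
  refine ⟨_, fenchelConj_lift_affine hz hzi, fun y r hr => ?_⟩
  have htop := ne_top_of_le_ne_top (EReal.coe_ne_top r) hr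
  have hy := block_of_fenchelConj_liftFun_ne_top (x₀ := 0) (EReal.coe_ne_bot _)
    (EReal.coe_ne_top _) htop
  rw [fenchelConj_liftFun hy] at htop
  have hyi := eq_of_fenchelConj_affine_ne_top htop
  have hyz : y = z := by rw [eq_blockVec hy, eq_blockVec hz, hyi, hzi]
  rw [hyz, fenchelConj_lift_affine hz hzi, EReal.coe_le_coe_iff] at hr
  rw [hyz, sub_self, inner_zero_right, add_zero]
  exact hr

theorem IsRun.bigFm_succ (hrun : T.IsRun) (hn : 1 ≤ n) (hw : w < T.wbar) {a : DualIdx P.G m}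
    (ha : a ∉ T.S n (w + 1)) : T.bigFm n (w + 1) a = T.bigFm n w a := by
  rcases a with i | a
  · refine bigFm_inl_congr fun hi => ?_
    by_cases h : T.StepInV4 n (w + 1)
    · exact hrun.subalg_other n w hn hw h i hi ha
    · exact hrun.block_model n w hn hw h i hi
  · rfl

theorem IsRun.bigFm_block (hrun : T.IsRun) (hn : 1 ≤ n) (hw : w < T.wbar)
    (h : ¬ T.StepInV4 n (w + 1)) : T.bigFm n (w + 1) = T.bigFm n w := by
  funext a
  rcases a with i | a
  · exact bigFm_inl_congr fun hi => hrun.block_model n w hn hw h i hi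
  · rfl

theorem IsRun.block_le (hrun : T.IsRun) (hn : 1 ≤ n) (hw : w < T.wbar)
    (h : ¬ T.StepInV4 n (w + 1)) (y : DualIdx P.G m → ProdSpace V m)
    (hy : ∀ a, a ∉ T.S n (w + 1) → y a = T.z n (w + 1) a) :
    T.blockObj n (w + 1) (T.z n (w + 1)) ≤ T.blockObj n (w + 1) y :=
  hrun.block_min n w hn hw h y fun a ha => (hy a ha).trans (hrun.keep n w hn hw a ha)

theorem StepInV4.edge_notMem (h : T.StepInV4 n w) (a : EdgeIdx P.G m) :
    Sum.inr a ∉ T.S n w := by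
  intro ha
  obtain ⟨i, hi, -⟩ := h _ ha
  cases hi

theorem StepInV4.cls (h : T.StepInV4 n w) {i : V} (hi : Sum.inl i ∈ T.S n w) :
    P.cls i = .V₄ := by
  obtain ⟨j, hj, hc⟩ := h _ hi
  cases hj
  exact hc

theorem IsRun.isConjSubgradient (hrun : T.IsRun) (hn : 1 ≤ n) (hw : w < T.wbar)
    (hI : T.Invariant n w) {a : DualIdx P.G m} (ha : a ∈ T.S n (w + 1)) :
    IsConjSubgradient (T.bigFm n (w + 1) a) (T.z n (w + 1) a) (T.iter n (w + 1)) := by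
  classical
  by_cases h : T.StepInV4 n (w + 1)
  · rcases a with i | a
    · obtain ⟨s, xp, v, -, -, -, -, hfm, hz, hzi⟩ :=
        hI.subalg_facts (h.cls ha) (hrun.subalg n w hn hw h i ha)
      rw [bigFm_model (h.cls ha), hfm]
      exact isConjSubgradient_lift_affine hz hzi _
    · exact absurd ha (h.edge_notMem a)
  · have hmin := hrun.block_le hn hw h
    have hfin := block_ne_top (fun a _ => exists_bigFm_ne_top n (w + 1) a)
      (fun a _ => by rw [hrun.bigFm_block hn hw h]; exact hI.exists_fenchelConj_ne_top a) hmin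
    refine ⟨T.conjVal n (w + 1) a, fenchelConj_eq_conjVal (hfin a ha), fun y r hr => ?_⟩
    -- Varying the single coordinate a splits the joint variational inequality into separate ones.
    have := block_variational (p := T.conjVal n (w + 1))
      (q := Function.update (T.conjVal n (w + 1)) a r)
      (y := Function.update (T.z n (w + 1)) a y) hmin
      (fun b hb => fenchelConj_eq_conjVal (hfin b hb)) (fun b hb => ?_) (fun b hb => ?_)
    · rw [Finset.sum_update_of_mem ha, Finset.sum_update_of_mem (Finset.mem_univ a),
        Finset.sum_eq_add_sum_sdiff_singleton_of_mem ha (T.conjVal n (w + 1))] at this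
      have h2 : y + ∑ x ∈ Finset.univ \ {a}, T.z n (w + 1) x - ∑ a, T.z n (w + 1) a =
          y - T.z n (w + 1) a := by
        rw [Finset.sum_eq_add_sum_sdiff_singleton_of_mem (Finset.mem_univ a) (T.z n (w + 1))]
        abel
      rw [h2] at this
      change _ + ⟪T.iter n (w + 1), _⟫_ℝ ≤ _ at this
      linarith
    · by_cases hba : b = a
      · subst hba; simpa using hr
      · simpa [hba] using (fenchelConj_eq_conjVal (hfin b hb)).le
    · exact Function.update_of_ne (fun hba => hb (by rw [hba]; exact ha)) _ _

theorem IsConjSubgradient.ne_top {φ : ProdSpace V m → EReal} {z u : ProdSpace V m}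
    (h : IsConjSubgradient φ z u) : fenchelConj φ z ≠ ⊤ := by
  obtain ⟨p, hp, -⟩ := h
  rw [hp]
  exact EReal.coe_ne_top _

/-- For active indices, finiteness of the conjugate already forces the support or orthogonality
condition; inactive ones are unchanged. -/
theorem Invariant.succ (hI : T.Invariant n w) (hrun : T.IsRun) (hn : 1 ≤ n) (hw : w < T.wbar) :
    T.Invariant n (w + 1) := by
  have hact : ∀ a ∈ T.S n (w + 1),
      fenchelConj (T.bigFm n (w + 1) a) (T.z n (w + 1) a) ≠ ⊤ := fun a ha =>
    IsConjSubgradient.ne_top (hrun.isConjSubgradient hn hw hI ha)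
  have hmodel : ∀ i, P.cls i = .V₄ → T.fm n (w + 1) i = T.fm n w i ∨
      (Sum.inl i ∈ T.S n (w + 1) ∧ T.SubalgStep n w i) := by
    intro i hi
    by_cases h : T.StepInV4 n (w + 1)
    · by_cases hS : Sum.inl i ∈ T.S n (w + 1)
      · exact Or.inr ⟨hS, hrun.subalg n w hn hw h i hS⟩
      · exact Or.inl (hrun.subalg_other n w hn hw h i hi hS)
    · exact Or.inl (hrun.block_model n w hn hw h i hi)
  refine ⟨fun i => ?_, fun a => ?_, fun i hi => ?_, fun i hi => ?_⟩
  · by_cases hS : Sum.inl i ∈ T.S n (w + 1)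
    · exact block_of_fenchelConj_bigFm_ne_top (hact _ hS)
    · rw [hrun.keep n w hn hw _ hS]
      exact hI.node i
  · by_cases hS : Sum.inr a ∈ T.S n (w + 1)
    · exact mem_orthogonal_of_fenchelConj_indicator_ne_top _ (hact _ hS)
    · rw [hrun.keep n w hn hw _ hS]
      exact hI.edge a
  · rcases hmodel i hi with h | ⟨-, h⟩
    · rw [h]; exact hI.convex i hi
    · obtain ⟨s, xp, v, -, -, -, -, hfm, -, -⟩ := hI.subalg_facts hi h
      rw [hfm]
      refine ⟨convex_univ, fun x _ y _ a b _ _ hab => le_of_eq ?_⟩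
      beta_reduce
      rw [inner_sub_left, inner_sub_left, inner_sub_left, inner_add_left,
        inner_smul_left, inner_smul_left, smul_eq_mul, smul_eq_mul]
      have : b = 1 - a := by linarith
      rw [this]
      simp only [conj_trivial]
      ring
  · rcases hmodel i hi with h | ⟨-, h⟩
    · rw [h]; exact hI.le i hi
    · obtain ⟨s, xp, v, -, -, -, hle, hfm, -, -⟩ := hI.subalg_facts hi h
      rw [hfm]
      exact hle

theorem Invariant.next (hI : T.Invariant n T.wbar) (hrun : T.IsRun) (hn : 1 ≤ n) :
    T.Invariant (n + 1) 0 := by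
  refine ⟨fun i => ?_, hrun.edge_mem (n + 1) (by omega), fun i hi => ?_, fun i hi => ?_⟩
  · rw [hrun.next_node n hn]; exact hI.node i
  · rw [hrun.next_model n hn i hi]; exact hI.convex i hi
  · rw [hrun.next_model n hn i hi]; exact hI.le i hi

theorem IsRun.invariant_of_start (hrun : T.IsRun) (hn : 1 ≤ n) (h0 : T.Invariant n 0) :
    ∀ w, w ≤ T.wbar → T.Invariant n w := by
  intro w
  induction w with
  | zero => exact fun _ => h0
  | succ w ih => exact fun hw => (ih (by omega)).succ hrun hn (by omega)

theorem IsRun.invariant (hrun : T.IsRun) : ∀ n, 1 ≤ n → ∀ w, w ≤ T.wbar → T.Invariant n w := by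
  intro n hn
  induction n, hn using Nat.le_induction with
  | base =>
    exact hrun.invariant_of_start le_rfl ⟨hrun.init_node, hrun.edge_mem 1 le_rfl,
      hrun.init_model_convex, hrun.init_model_le⟩
  | succ n hn ih =>
    exact hrun.invariant_of_start (by omega) ((ih T.wbar le_rfl).next hrun hn)

theorem IsRun.conj_succ (hrun : T.IsRun) (hn : 1 ≤ n) (hw : w < T.wbar) {a : DualIdx P.G m}
    (ha : a ∉ T.S n (w + 1)) :
    fenchelConj (T.bigFm n (w + 1) a) (T.z n (w + 1) a) =
      fenchelConj (T.bigFm n w a) (T.z n w a) := by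
  rw [hrun.bigFm_succ hn hw ha, hrun.keep n w hn hw a ha]

theorem IsFinite.succ (hfin : T.IsFinite n w) (hrun : T.IsRun) (hn : 1 ≤ n) (hw : w < T.wbar) :
    T.IsFinite n (w + 1) := by
  intro a
  by_cases ha : a ∈ T.S n (w + 1)
  · exact IsConjSubgradient.ne_top
      (hrun.isConjSubgradient hn hw (hrun.invariant n hn w hw.le) ha)
  · rw [hrun.conj_succ hn hw ha]
    exact hfin a

theorem IsRun.conjVal_succ (hrun : T.IsRun) (hn : 1 ≤ n) (hw : w < T.wbar) {a : DualIdx P.G m}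
    (ha : a ∉ T.S n (w + 1)) : T.conjVal n (w + 1) a = T.conjVal n w a := by
  rw [conjVal, conjVal, hrun.conj_succ hn hw ha]

/-- Test the variational inequality with the previous dual variables and expand the square; the
inactive conjugates cancel. -/
theorem IsRun.progress_block (hrun : T.IsRun) (hn : 1 ≤ n) (hw : w < T.wbar)
    (h : ¬ T.StepInV4 n (w + 1)) (hfin : T.IsFinite n w) :
    T.cost n (w + 1) + 1 / 2 * ‖T.iter n (w + 1) - T.iter n w‖ ^ 2 ≤ T.cost n w := by
  classical
  have hfin' := hfin.succ hrun hn hw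
  have h1 := block_variational (p := T.conjVal n (w + 1)) (q := T.conjVal n w)
    (y := T.z n w) (hrun.block_le hn hw h)
    (fun b _ => fenchelConj_eq_conjVal (hfin' b))
    (fun b _ => by
      rw [hrun.bigFm_block hn hw h]
      exact (fenchelConj_eq_conjVal (hfin b)).le)
    (fun b hb => (hrun.keep n w hn hw b hb).symm)
  have h2 : ∑ a, T.z n w a - ∑ a, T.z n (w + 1) a = T.iter n (w + 1) - T.iter n w := by
    rw [iter, iter]; abel
  rw [h2] at h1
  change _ + ⟪T.iter n (w + 1), _⟫_ℝ ≤ _ at h1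
  have h3 : ∑ a ∈ (T.S n (w + 1))ᶜ, T.conjVal n (w + 1) a =
      ∑ a ∈ (T.S n (w + 1))ᶜ, T.conjVal n w a :=
    Finset.sum_congr rfl fun a ha => hrun.conjVal_succ hn hw (Finset.mem_compl.1 ha)
  have h4 := Finset.sum_add_sum_compl (T.S n (w + 1)) (T.conjVal n (w + 1))
  have h5 := Finset.sum_add_sum_compl (T.S n (w + 1)) (T.conjVal n w)
  rw [cost, cost, norm_sub_sq_real]
  rw [inner_sub_right, real_inner_self_eq_norm_sq] at h1
  linarith

theorem IsRun.centre_succ (hrun : T.IsRun) (hn : 1 ≤ n) (hw : w < T.wbar)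
    (h : T.StepInV4 n (w + 1)) : T.centre n (w + 1) = T.centre n w := by
  have : T.vH n (w + 1) = T.vH n w :=
    Finset.sum_congr rfl fun a _ => hrun.keep n w hn hw _ (h.edge_notMem a)
  funext i
  rw [centre, centre, this]

/-- The contribution of the node `i` to the negative dual objective. -/
noncomputable def nodeCost (T : P.Trace) (n w : ℕ) (i : V) : ℝ :=
  1 / 2 * ‖T.centre n w i - T.z n w (.inl i) i‖ ^ 2 + T.conjVal n w (.inl i)

/-- The centre does not move, since no edge is active, so `prox_progress` and `prox_gap` apply at
the node with the new affine model's conjugate. -/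
theorem IsRun.nodeCost_subalg (hrun : T.IsRun) (hn : 1 ≤ n) (hw : w < T.wbar)
    (h : T.StepInV4 n (w + 1)) (hfin : T.IsFinite n w) {i : V}
    (hS : Sum.inl i ∈ T.S n (w + 1)) :
    T.nodeCost n (w + 1) i + 1 / 2 * ‖T.z n w (.inl i) i - T.z n (w + 1) (.inl i) i‖ ^ 2
        ≤ T.nodeCost n w i ∧
      ∃ s, IsSubgradientAt (P.f i) s (T.iter n w i) ∧
        (P.f i (T.iter n w i)).toReal
            - (⟪T.z n w (.inl i) i, T.iter n w i⟫_ℝ - T.conjVal n w (.inl i)) ≤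
          (T.nodeCost n w i - T.nodeCost n (w + 1) i) + ‖s - T.z n w (.inl i) i‖ *
            √(2 * (T.nodeCost n w i - T.nodeCost n (w + 1) i)) := by
  have hI := hrun.invariant n hn w hw.le
  have hi := h.cls hS
  obtain ⟨s, xp, v, hs, hle, hsv, -, hfm, hz, hzi⟩ :=
    hI.subalg_facts hi (hrun.subalg n w hn hw h i hS)
  have hval : T.conjVal n (w + 1) (.inl i) = ⟪T.z n (w + 1) (.inl i) i, xp⟫_ℝ - v := by
    rw [conjVal, bigFm_model hi, hfm, fenchelConj_lift_affine hz hzi, EReal.toReal_coe, hzi]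
  have hold : fenchelConj (fun x => (T.fm n w i x : EReal)) (T.z n w (.inl i) i) =
      (T.conjVal n w (.inl i) : EReal) := by
    rw [← fenchelConj_liftFun (hI.node i), ← bigFm_model hi]
    exact fenchelConj_eq_conjVal (hfin _)
  have hyoung := fenchelConj_le_coe_iff.1 hold.le xp _ le_rfl
  have hprog := prox_progress hzi hyoung hle
  have hnew : T.nodeCost n (w + 1) i = 1 / 2 *
      ‖T.centre n w i - T.z n (w + 1) (.inl i) i‖ ^ 2 +
        (⟪T.z n (w + 1) (.inl i) i, xp⟫_ℝ - v) := by
    rw [nodeCost, hrun.centre_succ hn hw h, hval]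
  have hmain : T.nodeCost n (w + 1) i +
      1 / 2 * ‖T.z n w (.inl i) i - T.z n (w + 1) (.inl i) i‖ ^ 2 ≤ T.nodeCost n w i := by
    rw [hnew, nodeCost]
    linarith
  refine ⟨hmain, s, hs, ?_⟩
  refine prox_gap (r := T.conjVal n w (.inl i)) hzi (hI.iter_apply i) rfl hsv (by linarith) ?_
  rw [← hnew]
  change _ = T.nodeCost n w i
  ring

theorem IsRun.nodeCost_keep (hrun : T.IsRun) (hn : 1 ≤ n) (hw : w < T.wbar)
    (h : T.StepInV4 n (w + 1)) {i : V} (hS : Sum.inl i ∉ T.S n (w + 1)) :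
    T.nodeCost n (w + 1) i + 1 / 2 * ‖T.z n w (.inl i) i - T.z n (w + 1) (.inl i) i‖ ^ 2
      = T.nodeCost n w i := by
  rw [nodeCost, nodeCost, hrun.centre_succ hn hw h, hrun.keep n w hn hw _ hS,
    hrun.conjVal_succ hn hw hS]
  simp

theorem IsRun.nodeCost_le (hrun : T.IsRun) (hn : 1 ≤ n) (hw : w < T.wbar)
    (h : T.StepInV4 n (w + 1)) (hfin : T.IsFinite n w) (i : V) :
    T.nodeCost n (w + 1) i + 1 / 2 * ‖T.z n w (.inl i) i - T.z n (w + 1) (.inl i) i‖ ^ 2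
      ≤ T.nodeCost n w i := by
  by_cases hS : Sum.inl i ∈ T.S n (w + 1)
  · exact (hrun.nodeCost_subalg hn hw h hfin hS).1
  · exact (hrun.nodeCost_keep hn hw h hS).le

theorem IsRun.progress (hrun : T.IsRun) (hn : 1 ≤ n) (hw : w < T.wbar)
    (hfin : T.IsFinite n w) :
    T.cost n (w + 1) + 1 / 2 * ‖T.iter n (w + 1) - T.iter n w‖ ^ 2 ≤ T.cost n w := by
  by_cases h : T.StepInV4 n (w + 1)
  · have hI := hrun.invariant n hn w hw.le
    have hI' := hrun.invariant n hn (w + 1) hw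
    have h1 : ‖T.iter n (w + 1) - T.iter n w‖ ^ 2 =
        ∑ i, ‖T.z n w (.inl i) i - T.z n (w + 1) (.inl i) i‖ ^ 2 := by
      rw [PiLp.norm_sq_eq_of_L2]
      refine Finset.sum_congr rfl fun i _ => ?_
      rw [PiLp.sub_apply, hI.iter_apply, hI'.iter_apply, hrun.centre_succ hn hw h]
      congr 2
      abel
    rw [hI.cost_eq, hI'.cost_eq, h1, Finset.mul_sum, ← Finset.sum_add_distrib]
    exact Finset.sum_le_sum fun i _ => hrun.nodeCost_le hn hw h hfin i
  · exact hrun.progress_block hn hw h hfin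

/-- The Fenchel gap of `f_i` at a node of `V₄` is controlled by the progress of the step. -/
theorem IsRun.subalg_gap (hrun : T.IsRun) (hn : 1 ≤ n) (hw : w < T.wbar)
    (h : T.StepInV4 n (w + 1)) (hfin : T.IsFinite n w) {i : V}
    (hS : Sum.inl i ∈ T.S n (w + 1)) :
    ∃ s, IsSubgradientAt (P.f i) s (T.iter n w i) ∧
      (P.f i (T.iter n w i)).toReal
          - (⟪T.z n w (.inl i) i, T.iter n w i⟫_ℝ - T.conjVal n w (.inl i)) ≤
        (T.cost n w - T.cost n (w + 1)) + ‖s - T.z n w (.inl i) i‖ *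
          √(2 * (T.cost n w - T.cost n (w + 1))) := by
  have hD : T.nodeCost n w i - T.nodeCost n (w + 1) i ≤ T.cost n w - T.cost n (w + 1) := by
    rw [(hrun.invariant n hn w hw.le).cost_eq, (hrun.invariant n hn (w + 1) hw).cost_eq,
      ← Finset.sum_sub_distrib]
    refine Finset.single_le_sum
      (f := fun i => T.nodeCost n w i - T.nodeCost n (w + 1) i) (fun j _ => ?_)
      (Finset.mem_univ i)
    have := hrun.nodeCost_le hn hw h hfin j
    have := sq_nonneg ‖T.z n w (.inl j) j - T.z n (w + 1) (.inl j) j‖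
    linarith
  obtain ⟨-, s, hs, hgap⟩ := hrun.nodeCost_subalg hn hw h hfin hS
  refine ⟨s, hs, hgap.trans (add_le_add hD (mul_le_mul_of_nonneg_left ?_ (norm_nonneg _)))⟩
  exact Real.sqrt_le_sqrt (by linarith)

end Trace

end DistProblem

/-! ### The scalar recursion. -/

/-- All terms on the right are O(√(h n - h (n + 2))), so h(n+1)² is bounded by a telescoping
difference over two steps. Monotonicity then bounds n·h(n)². -/
theorem exists_rate_of_recursion {h : ℕ → ℝ} {A A' A'' : ℝ} (hA : 0 ≤ A) (hA' : 0 ≤ A')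
    (hA'' : 0 ≤ A'') (hpos : ∀ n, 2 ≤ n → 0 ≤ h n) (hanti : ∀ n, 2 ≤ n → h (n + 1) ≤ h n)
    (hrec : ∀ n, 2 ≤ n → h (n + 1) ≤ A * √(2 * (h n - h (n + 1))) +
      A' * ((h (n + 1) - h (n + 2)) + A'' * √(2 * (h (n + 1) - h (n + 2))))) :
    ∃ C : ℝ, ∀ n : ℕ, 2 ≤ n → h n ≤ C / (n : ℝ) ^ (1 / 3 : ℝ) := by
  have hle2 : ∀ n, 2 ≤ n → h n ≤ h 2 := by
    intro n hn
    induction n, hn using Nat.le_induction with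
    | base => exact le_rfl
    | succ n hn ih => exact (hanti n hn).trans ih
  set Q := A + A' * (√(h 2) + A'') with hQ
  have hQ0 : 0 ≤ Q := by positivity
  have hsq : ∀ n, 2 ≤ n → h (n + 1) ^ 2 ≤ 2 * Q ^ 2 * (h n - h (n + 2)) := by
    intro n hn
    have h1 := hanti n hn
    have h2 := hanti (n + 1) (by omega)
    have h3 := hpos (n + 2) (by omega)
    have h4 := hle2 (n + 1) (by omega)
    have hd : 0 ≤ 2 * (h n - h (n + 2)) := by linarith
    set d := 2 * (h n - h (n + 2)) with hd'
    have e1 : √(2 * (h n - h (n + 1))) ≤ √d := Real.sqrt_le_sqrt (by linarith)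
    have e2 : √(2 * (h (n + 1) - h (n + 2))) ≤ √d := Real.sqrt_le_sqrt (by linarith)
    -- The linear decrease becomes a square root at the price of the factor √(h 2).
    have e3 : h (n + 1) - h (n + 2) ≤ √d * √(h 2) := by
      have ht : 0 ≤ h (n + 1) - h (n + 2) := by linarith
      calc h (n + 1) - h (n + 2)
          = √(h (n + 1) - h (n + 2)) * √(h (n + 1) - h (n + 2)) := (Real.mul_self_sqrt ht).symm
        _ ≤ √d * √(h 2) := mul_le_mul (Real.sqrt_le_sqrt (by linarith))
            (Real.sqrt_le_sqrt (by linarith)) (Real.sqrt_nonneg _) (Real.sqrt_nonneg _)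
    have e4 : h (n + 1) ≤ Q * √d := by
      refine (hrec n hn).trans ?_
      have f1 := mul_le_mul_of_nonneg_left e1 hA
      have f2 := mul_le_mul_of_nonneg_left
        (add_le_add e3 (mul_le_mul_of_nonneg_left e2 hA'')) hA'
      refine (add_le_add f1 f2).trans (le_of_eq ?_)
      rw [hQ]; ring
    calc h (n + 1) ^ 2 ≤ (Q * √d) ^ 2 := pow_le_pow_left₀ (hpos (n + 1) (by omega)) e4 2
      _ = Q ^ 2 * d := by rw [mul_pow, Real.sq_sqrt hd]
      _ = 2 * Q ^ 2 * (h n - h (n + 2)) := by rw [hd']; ring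
  -- Two consecutive values of h appear in the potential because the difference in `hsq` spans two
  -- indices.
  have hsum : ∀ n : ℕ, 1 ≤ n → ((n : ℝ) - 1) * h (n + 1) ^ 2 + 2 * Q ^ 2 * (h (n + 1) + h (n + 2)) ≤
      4 * Q ^ 2 * h 2 := by
    intro n hn
    induction n, hn using Nat.le_induction with
    | base =>
      have := mul_le_mul_of_nonneg_left (hanti 2 le_rfl) (by positivity : 0 ≤ 2 * Q ^ 2)
      norm_num
      linarith
    | succ n hn ih =>
      have h1 := hsq (n + 1) (by omega)
      have h2 := pow_le_pow_left₀ (hpos (n + 2) (by omega)) (hanti (n + 1) (by omega)) 2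
      have hn' : (0 : ℝ) ≤ (n : ℝ) - 1 := by
        have : (1 : ℝ) ≤ n := by exact_mod_cast hn
        linarith
      have h3 := mul_le_mul_of_nonneg_left h2 hn'
      push_cast
      have e : n + 1 + 1 = n + 2 := rfl
      have e' : n + 1 + 2 = n + 3 := rfl
      rw [e, e'] at *
      linarith
  set K := 4 * Q ^ 2 * h 2 + 2 * h 2 ^ 2 with hK
  have hKn : ∀ n : ℕ, 2 ≤ n → n * h n ^ 2 ≤ K := by
    intro n hn
    obtain ⟨k, rfl⟩ : ∃ k, n = k + 1 := ⟨n - 1, by omega⟩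
    have h1 := hsum k (by omega)
    have h2 := pow_le_pow_left₀ (hpos (k + 1) hn) (hle2 (k + 1) hn) 2
    have h3 : 0 ≤ 2 * Q ^ 2 * (h (k + 1) + h (k + 2)) :=
      mul_nonneg (by positivity) (add_nonneg (hpos _ hn) (hpos _ (by omega)))
    push_cast
    linarith
  refine ⟨√K, fun n hn => ?_⟩
  have hn0 : (0 : ℝ) < n := by positivity
  have hn1 : (1 : ℝ) ≤ n := by exact_mod_cast (by omega : 1 ≤ n)
  rw [le_div_iff₀ (Real.rpow_pos_of_pos hn0 _)]
  have hpow : (n : ℝ) ^ (1 / 3 : ℝ) ≤ √n := by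
    rw [Real.sqrt_eq_rpow]
    exact Real.rpow_le_rpow_of_exponent_le hn1 (by norm_num)
  refine (mul_le_mul_of_nonneg_left hpow (hpos n hn)).trans (Real.le_sqrt_of_sq_le ?_)
  rw [mul_pow, Real.sq_sqrt hn0.le, mul_comm]
  exact hKn n hn

/-! ### The dual gap at the end of an outer iteration. -/

/-- The conjugate is the indicator of Kᗮ, so u is orthogonal to Kᗮ, and K equals its double
complement. -/
theorem mem_of_isConjSubgradient_indicator {H : Type*} [NormedAddCommGroup H]
    [InnerProductSpace ℝ H] [FiniteDimensional ℝ H] {K : Submodule ℝ H} {z u : H}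
    (h : IsConjSubgradient (indicatorFun (K : Set H)) z u) : u ∈ K := by
  obtain ⟨p, hp, hu⟩ := h
  have hz : z ∈ Kᗮ := mem_orthogonal_of_fenchelConj_indicator_ne_top K (by
    rw [hp]; exact EReal.coe_ne_top _)
  have hp0 : p = 0 := by
    rw [fenchelConj_indicator_submodule K hz] at hp
    exact_mod_cast hp.symm
  have hle : ∀ t ∈ Kᗮ, ⟪u, t⟫_ℝ ≤ 0 := fun t ht => by
    have := hu (z + t) 0 (by
      rw [fenchelConj_indicator_submodule K (Submodule.add_mem _ hz ht)]; rfl)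
    rw [hp0, zero_add, add_sub_cancel_left] at this
    exact this
  rw [← Submodule.orthogonal_orthogonal K, Submodule.mem_orthogonal']
  intro t ht
  have h1 := hle (-t) (Submodule.neg_mem _ ht)
  rw [inner_neg_right] at h1
  exact le_antisymm (hle t ht) (by linarith)

namespace DistProblem

namespace Trace

variable {V : Type*} [Fintype V] {m : ℕ} {P : DistProblem V m} {T : P.Trace} {n w : ℕ}

/-- q is the last activation of a up to step w; afterwards neither its dual variable nor its
function changes. -/
theorem IsRun.exists_isConjSubgradient (hrun : T.IsRun) (hn : 1 ≤ n) {a : DualIdx P.G m} :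
    ∀ w, w ≤ T.wbar → (∃ w', 1 ≤ w' ∧ w' ≤ w ∧ a ∈ T.S n w') →
      ∃ q, q ≤ w ∧ IsConjSubgradient (T.bigFm n w a) (T.z n w a) (T.iter n q) := by
  intro w
  induction w with
  | zero => rintro - ⟨w', h1, h2, -⟩; omega
  | succ w ih =>
    rintro hw ⟨w', h1, h2, ha'⟩
    by_cases ha : a ∈ T.S n (w + 1)
    · exact ⟨w + 1, le_rfl, hrun.isConjSubgradient hn hw (hrun.invariant n hn w (by omega)) ha⟩
    · have hne : w' ≠ w + 1 := fun h => ha (by rw [← h]; exact ha')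
      obtain ⟨q, hq, h⟩ := ih (by omega) ⟨w', h1, by omega, ha'⟩
      refine ⟨q, by omega, ?_⟩
      rw [hrun.bigFm_succ hn hw ha, hrun.keep n w hn hw a ha]
      exact h

/-- The initial duals may have infinite conjugates, but each node is active during the iteration.
This is why costs are used only from n = 2 on. -/
theorem IsRun.isFinite_end (hrun : T.IsRun) (hassu : T.StandingAssumptions) (hn : 1 ≤ n) :
    T.IsFinite n T.wbar := by
  rintro (i | a)
  · obtain ⟨q, -, h⟩ := hrun.exists_isConjSubgradient hn T.wbar le_rfl (hassu.nodes_used n hn i)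
    exact IsConjSubgradient.ne_top h
  · rw [(hrun.invariant n hn T.wbar le_rfl).fenchelConj_edge]
    exact EReal.zero_ne_top

theorem IsRun.iter_next (hrun : T.IsRun) (hn : 1 ≤ n) : T.iter (n + 1) 0 = T.iter n T.wbar := by
  rw [iter, iter, Fintype.sum_sum_type, Fintype.sum_sum_type]
  congr 2
  · exact Finset.sum_congr rfl fun i _ => hrun.next_node n hn i
  · exact hrun.next_edge n hn

/-- Redistribution changes individual edge variables, but their conjugates all stay 0. -/
theorem IsRun.conj_next (hrun : T.IsRun) (hn : 1 ≤ n) (a : DualIdx P.G m) :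
    fenchelConj (T.bigFm (n + 1) 0 a) (T.z (n + 1) 0 a) =
      fenchelConj (T.bigFm n T.wbar a) (T.z n T.wbar a) := by
  rcases a with i | a
  · rw [hrun.next_node n hn, bigFm_inl_congr (hrun.next_model n hn i)]
  · rw [(hrun.invariant n hn T.wbar le_rfl).fenchelConj_edge,
      (hrun.invariant (n + 1) (by omega) 0 (Nat.zero_le _)).fenchelConj_edge]

theorem IsRun.conjVal_next (hrun : T.IsRun) (hn : 1 ≤ n) (a : DualIdx P.G m) :
    T.conjVal (n + 1) 0 a = T.conjVal n T.wbar a := by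
  rw [conjVal, conjVal, hrun.conj_next hn]

theorem IsRun.cost_next (hrun : T.IsRun) (hn : 1 ≤ n) :
    T.cost (n + 1) 0 = T.cost n T.wbar := by
  simp only [cost, hrun.iter_next hn, hrun.conjVal_next hn]

theorem IsRun.isFinite (hrun : T.IsRun) (hassu : T.StandingAssumptions) (hn : 2 ≤ n) :
    ∀ w, w ≤ T.wbar → T.IsFinite n w := by
  intro w
  induction w with
  | zero =>
    intro _ a
    obtain ⟨k, rfl⟩ : ∃ k, n = k + 1 := ⟨n - 1, by omega⟩
    rw [hrun.conj_next (by omega)]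
    exact hrun.isFinite_end hassu (by omega) a
  | succ w ih => exact fun hw => (ih (by omega)).succ hrun (by omega) hw

theorem IsRun.cost_le (hrun : T.IsRun) (hassu : T.StandingAssumptions) (hn : 2 ≤ n) {w w' : ℕ}
    (hww' : w ≤ w') (hw' : w' ≤ T.wbar) : T.cost n w' ≤ T.cost n w := by
  induction w', hww' using Nat.le_induction with
  | base => exact le_rfl
  | succ w' _ ih =>
    refine le_trans ?_ (ih (by omega))
    have := hrun.progress (by omega) hw' (hrun.isFinite hassu hn w' (by omega))
    have := sq_nonneg ‖T.iter n (w' + 1) - T.iter n w'‖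
    linarith

/-- Each step moves by at most √(2D), D being the decrease over the whole iteration. Both iterates
are compared with the starting one, hence the factor 2. -/
theorem IsRun.norm_iter_sub_le (hrun : T.IsRun) (hassu : T.StandingAssumptions) (hn : 2 ≤ n)
    (hw : w ≤ T.wbar) :
    ‖T.iter n T.wbar - T.iter n w‖ ≤
      2 * T.wbar * √(2 * (T.cost n 0 - T.cost n T.wbar)) := by
  set e := √(2 * (T.cost n 0 - T.cost n T.wbar)) with he
  have he0 : 0 ≤ e := Real.sqrt_nonneg _
  have hstep : ∀ w, w ≤ T.wbar → ‖T.iter n w - T.iter n 0‖ ≤ w * e := by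
    intro w
    induction w with
    | zero => simp
    | succ w ih =>
      intro hw
      have h1 := hrun.progress (by omega) hw (hrun.isFinite hassu hn w (by omega))
      have h2 := hrun.cost_le hassu hn (Nat.zero_le w) (by omega)
      have h3 := hrun.cost_le hassu hn hw le_rfl
      have h4 : ‖T.iter n (w + 1) - T.iter n w‖ ≤ e := Real.le_sqrt_of_sq_le (by linarith)
      have h5 : T.iter n (w + 1) - T.iter n 0 =
          (T.iter n (w + 1) - T.iter n w) + (T.iter n w - T.iter n 0) := by abel
      rw [h5]
      push_cast
      linarith [norm_add_le (T.iter n (w + 1) - T.iter n w) (T.iter n w - T.iter n 0),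
        ih (by omega)]
  have h1 : T.iter n T.wbar - T.iter n w =
      (T.iter n T.wbar - T.iter n 0) - (T.iter n w - T.iter n 0) := by abel
  have h2 : (w : ℝ) * e ≤ T.wbar * e := mul_le_mul_of_nonneg_right (by exact_mod_cast hw) he0
  rw [h1]
  linarith [norm_sub_le (T.iter n T.wbar - T.iter n 0) (T.iter n w - T.iter n 0),
    hstep T.wbar le_rfl, hstep w hw]

/-- The estimate of the dual gap at the end of an outer iteration. -/
theorem IsRun.gap_le (hrun : T.IsRun) (hassu : T.StandingAssumptions) (hn : 1 ≤ n)
    {y : DualIdx P.G m → ProdSpace V m} {r : DualIdx P.G m → ℝ}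
    (hr : ∀ a, fenchelConj (P.bigF a) (y a) = (r a : EReal)) {κ B ε δ : ℝ} (hκ : 0 ≤ κ)
    (hdec : ∀ u ∈ (⨅ a ∈ T.Ebar n, edgeSubspace a : Submodule ℝ (ProdSpace V m))ᗮ,
      ∃ g : EdgeIdx P.G m → ProdSpace V m, (∀ a, g a ∈ (edgeSubspace a)ᗮ) ∧
        (∀ a, a ∉ T.Ebar n → g a = 0) ∧ ∑ a, g a = u ∧ ∀ a, ‖g a‖ ≤ κ * ‖u‖)
    (hy : ∀ i, ‖y (.inl i)‖ ≤ B) (hyE : ‖∑ a, y (.inr a)‖ ≤ B)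
    (hz : ∀ i, ‖T.z n T.wbar (.inl i)‖ ≤ B) (hzE : ‖T.vH n T.wbar‖ ≤ B)
    (hε : ∀ w, w ≤ T.wbar → ‖T.iter n T.wbar - T.iter n w‖ ≤ ε) (hδ0 : 0 ≤ δ)
    (hδ : ∀ i, P.cls i = .V₄ → (P.f i (T.iter n T.wbar i)).toReal
      - (⟪T.z n T.wbar (.inl i) i, T.iter n T.wbar i⟫_ℝ - T.conjVal n T.wbar (.inl i)) ≤ δ) :
    T.cost n T.wbar - (1 / 2 * ‖P.xbar - ∑ a, y a‖ ^ 2 + ∑ a, r a) ≤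
      Fintype.card (EdgeIdx P.G m) * (ε * (κ * (2 * B))) + Fintype.card V * (ε * (2 * B) + δ) := by
  have hI := hrun.invariant n hn T.wbar le_rfl
  have hε0 : 0 ≤ ε := (norm_nonneg _).trans (hε 0 (Nat.zero_le _))
  have hyn : ∀ i j, j ≠ i → y (.inl i) j = 0 := fun i =>
    P.block_of_fenchelConj_bigF_ne_top (by rw [hr]; exact EReal.coe_ne_top _)
  have hye : ∀ a, y (.inr a) ∈ (edgeSubspace a)ᗮ := fun a => (edge_mem_of_conj_bigF (hr _)).1
  set x := T.iter n T.wbar with hx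
  have hyz : ∀ i, ‖y (.inl i) - T.z n T.wbar (.inl i)‖ ≤ 2 * B := fun i =>
    (norm_sub_le _ _).trans (by linarith [hy i, hz i])
  have hB0 : ‖∑ a, y (.inr a) - T.vH n T.wbar‖ ≤ 2 * B :=
    (norm_sub_le _ _).trans (by linarith)
  have hB : 0 ≤ 2 * B := (norm_nonneg _).trans hB0
  have hnode : ∀ i, T.conjVal n T.wbar (.inl i) - r (.inl i)
      + ⟪x, y (.inl i) - T.z n T.wbar (.inl i)⟫_ℝ ≤ ε * (2 * B) + δ := by
    intro i
    by_cases hi : P.cls i = .V₄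
    -- At a node of V₄, Fenchel–Young for the true f_i bounds the comparison dual, and δ pays for
    -- the model.
    · have hdom : P.f i (x i) ≠ ⊤ := by
        have : x i ∈ effDom (P.f i) := by rw [P.cls_four i hi]; trivial
        exact this
      have h1 : fenchelConj (P.f i) (y (.inl i) i) = (r (.inl i) : EReal) := by
        rw [← fenchelConj_liftFun (hyn i)]
        exact hr (.inl i)
      have h2 := fenchelConj_le_coe_iff.1 h1.le (x i) _
        (EReal.coe_toReal hdom ((P.closedConvex i).ne_bot _)).ge
      have h3 : ⟪x, y (.inl i) - T.z n T.wbar (.inl i)⟫_ℝ =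
          ⟪y (.inl i) i, x i⟫_ℝ - ⟪T.z n T.wbar (.inl i) i, x i⟫_ℝ := by
        rw [real_inner_comm, inner_sub_left, inner_eq_of_block (hyn i),
          inner_eq_of_block (hI.node i)]
      have h4 := hδ i hi
      have h5 : 0 ≤ ε * (2 * B) := mul_nonneg hε0 hB
      linarith
    -- Elsewhere the subgradient is the iterate of the last activation; replacing it by the final
    -- one costs ε times the distance of the duals.
    · obtain ⟨q, hq, p, hp, hsub⟩ :=
        hrun.exists_isConjSubgradient hn T.wbar le_rfl (hassu.nodes_used n hn i)
      have h1 := hsub (y (.inl i)) (r (.inl i)) (by rw [bigFm_node hi]; exact (hr _).le)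
      have h2 : T.conjVal n T.wbar (.inl i) = p := by rw [conjVal, hp, EReal.toReal_coe]
      have h3 := (real_inner_le_norm (x - T.iter n q)
        (y (.inl i) - T.z n T.wbar (.inl i))).trans
        (mul_le_mul (hε q hq) (hyz i) (norm_nonneg _) hε0)
      rw [inner_sub_left] at h3
      linarith
  have hedge : ⟪x, ∑ a, y (.inr a) - T.vH n T.wbar⟫_ℝ ≤
      Fintype.card (EdgeIdx P.G m) * (ε * (κ * (2 * B))) := by
    -- Both edge sums lie in Dᗮ; as Ē_n connects V, the difference decomposes over edges active in
    -- this iteration.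
    have hmem : ∑ a, y (.inr a) - T.vH n T.wbar ∈
        (⨅ a ∈ T.Ebar n, edgeSubspace a : Submodule ℝ (ProdSpace V m))ᗮ := by
      rw [hrun.connects n hn]
      have hle : ∀ a : EdgeIdx P.G m, (edgeSubspace a)ᗮ ≤
          (⨅ a : EdgeIdx P.G m, edgeSubspace a : Submodule ℝ (ProdSpace V m))ᗮ := fun a =>
        Submodule.orthogonal_le (iInf_le _ a)
      exact Submodule.sub_mem _ (Submodule.sum_mem _ fun a _ => hle a (hye a))
        (Submodule.sum_mem _ fun a _ => hle a (hI.edge a))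
    obtain ⟨g, hg, hg0, hgsum, hgn⟩ := hdec _ hmem
    rw [← hgsum, inner_sum]
    have hterm : ∀ a, ⟪x, g a⟫_ℝ ≤ ε * (κ * (2 * B)) := by
      intro a
      by_cases ha : a ∈ T.Ebar n
      · obtain ⟨q, hq, hsub⟩ :=
          hrun.exists_isConjSubgradient hn T.wbar le_rfl (hassu.edges_used n hn a ha)
        have hmemq : T.iter n q ∈ edgeSubspace a := mem_of_isConjSubgradient_indicator hsub
        have h1 : ⟪T.iter n q, g a⟫_ℝ = 0 := (Submodule.mem_orthogonal _ _).1 (hg a) _ hmemq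
        have h2 := (real_inner_le_norm (x - T.iter n q) (g a)).trans
          (mul_le_mul (hε q hq) ((hgn a).trans (mul_le_mul_of_nonneg_left hB0 hκ))
            (norm_nonneg _) hε0)
        rw [inner_sub_left, h1, sub_zero] at h2
        exact h2
      · rw [hg0 a ha, inner_zero_right]
        exact mul_nonneg hε0 (mul_nonneg hκ hB)
    refine (Finset.sum_le_sum fun a _ => hterm a).trans (le_of_eq ?_)
    simp
  have hsumnode := (Finset.sum_le_sum fun i (_ : i ∈ Finset.univ) => hnode i)
  rw [Finset.sum_add_distrib, Finset.sum_sub_distrib, ← inner_sum] at hsumnode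
  have hcard : ∑ _i : V, (ε * (2 * B) + δ) = Fintype.card V * (ε * (2 * B) + δ) := by
    rw [Finset.sum_const, nsmul_eq_mul, Finset.card_univ]
  rw [hcard] at hsumnode
  set d := ∑ a, y a - ∑ a, T.z n T.wbar a with hd
  have hd1 : d = ∑ i, (y (.inl i) - T.z n T.wbar (.inl i)) +
      (∑ a, y (.inr a) - T.vH n T.wbar) := by
    rw [hd, vH, Fintype.sum_sum_type, Fintype.sum_sum_type, Finset.sum_sub_distrib]
    abel
  have hd2 : P.xbar - ∑ a, y a = x - d := by rw [hx, hd, iter]; abel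
  have hd3 : ⟪x, d⟫_ℝ = ⟪x, ∑ i, (y (.inl i) - T.z n T.wbar (.inl i))⟫_ℝ +
      ⟪x, ∑ a, y (.inr a) - T.vH n T.wbar⟫_ℝ := by rw [hd1, inner_add_right]
  have hs1 : ∑ a, r a = ∑ i, r (.inl i) := by
    rw [Fintype.sum_sum_type, add_eq_left]
    exact Finset.sum_eq_zero fun a _ => (edge_mem_of_conj_bigF (hr _)).2
  have hs2 : ∑ a, T.conjVal n T.wbar a = ∑ i, T.conjVal n T.wbar (.inl i) := by
    rw [Fintype.sum_sum_type, add_eq_left]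
    exact Finset.sum_eq_zero fun a _ => hI.conjVal_edge a
  rw [cost, hd2, hs1, hs2, norm_sub_sq_real, ← hx]
  have := sq_nonneg ‖d‖
  linarith

end Trace

end DistProblem

/-! ### Uniform constants and the rate. -/

theorem IsClosedConvex.convexOn_toReal {H : Type*} [NormedAddCommGroup H] [InnerProductSpace ℝ H]
    {f : H → EReal} (hf : IsClosedConvex f) (hdom : effDom f = Set.univ) :
    ConvexOn ℝ Set.univ fun x => (f x).toReal := by
  have hcoe : ∀ x, f x = ((f x).toReal : EReal) := fun x =>
    (EReal.coe_toReal (by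
      have : x ∈ effDom f := by rw [hdom]; trivial
      exact this) (hf.ne_bot x)).symm
  refine ⟨convex_univ, fun x _ y _ a b ha hb hab => ?_⟩
  have h := hf.convex_epi (show (x, (f x).toReal) ∈ {p : H × ℝ | f p.1 ≤ (p.2 : EReal)} from
    (hcoe x).le) (show (y, (f y).toReal) ∈ {p : H × ℝ | f p.1 ≤ (p.2 : EReal)} from
    (hcoe y).le) ha hb hab
  have h' : f (a • x + b • y) ≤ ((a • (f x).toReal + b • (f y).toReal : ℝ) : EReal) := h
  rw [hcoe (a • x + b • y), EReal.coe_le_coe_iff] at h'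
  exact h'

namespace DistProblem

variable {V : Type*} [Fintype V] {m : ℕ} {P : DistProblem V m}

theorem exists_bound_isSubgradientAt (P : DistProblem V m) (R : ℝ) :
    ∃ L : ℝ, 0 ≤ L ∧ ∀ i, P.cls i = .V₄ → ∀ p s : Euc m, ‖p‖ ≤ R →
      IsSubgradientAt (P.f i) s p → ‖s‖ ≤ L := by
  have h : ∀ i, ∃ L : ℝ, P.cls i = .V₄ → ∀ p s : Euc m, ‖p‖ ≤ R →
      IsSubgradientAt (P.f i) s p → ‖s‖ ≤ L := by
    intro i
    by_cases hi : P.cls i = .V₄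
    · obtain ⟨L, hL⟩ := exists_bound_subgradient
        ((P.closedConvex i).convexOn_toReal (P.cls_four i hi)) R
      refine ⟨L, fun _ p s hp hs => hL p s hp fun x => ?_⟩
      have hx : P.f i x ≠ ⊤ := by
        have : x ∈ effDom (P.f i) := by rw [P.cls_four i hi]; trivial
        exact this
      have h1 := hs.2 x
      rw [← EReal.coe_toReal hx ((P.closedConvex i).ne_bot x),
        ← EReal.coe_toReal hs.1 ((P.closedConvex i).ne_bot p), ← EReal.coe_add,
        EReal.coe_le_coe_iff] at h1
      exact h1
    · exact ⟨0, fun h => absurd h hi⟩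
  choose L hL using h
  obtain ⟨M, hM⟩ := Finite.exists_le L
  exact ⟨max M 0, le_max_right _ _, fun i hi p s hp hs =>
    (hL i hi p s hp hs).trans ((hM i).trans (le_max_left _ _))⟩

namespace Trace

variable {T : P.Trace}

/-- The dual gap decreases at the rate `O(1/n^{1/3})`. -/
theorem IsRun.exists_rate (hrun : T.IsRun) (hassu : T.StandingAssumptions)
    {zs : DualIdx P.G m → ProdSpace V m} {r : DualIdx P.G m → ℝ}
    (hr : ∀ a, fenchelConj (P.bigF a) (zs a) = (r a : EReal)) {B : ℝ}
    (hzs : ∀ i, ‖zs (.inl i)‖ ≤ B) (hzsE : ‖∑ a, zs (.inr a)‖ ≤ B)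
    (hz : ∀ n, 2 ≤ n → ∀ w, w ≤ T.wbar → (∀ i, ‖T.z n w (.inl i)‖ ≤ B) ∧
      ‖∑ a, T.z n w a‖ ≤ B ∧ ‖T.vH n w‖ ≤ B)
    (hopt : ∀ n, 2 ≤ n → 1 / 2 * ‖P.xbar - ∑ a, zs a‖ ^ 2 + ∑ a, r a ≤ T.cost n 0) :
    ∃ C : ℝ, ∀ n : ℕ, 2 ≤ n →
      T.cost n 0 - (1 / 2 * ‖P.xbar - ∑ a, zs a‖ ^ 2 + ∑ a, r a) ≤ C / (n : ℝ) ^ (1 / 3 : ℝ) := by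
  set cs := 1 / 2 * ‖P.xbar - ∑ a, zs a‖ ^ 2 + ∑ a, r a with hcs
  have hB0 : 0 ≤ B := (norm_nonneg _).trans hzsE
  choose κ hκ0 hdec using fun E : Set (EdgeIdx P.G m) =>
    exists_bounded_decomposition_orthogonal
      (fun a : EdgeIdx P.G m => (edgeSubspace a : Submodule ℝ (ProdSpace V m))) E
  -- There are finitely many edge sets, so one constant serves all Ē_n.
  obtain ⟨κ', hκ'⟩ := Finite.exists_le κ
  have hκ'0 : 0 ≤ κ' := (hκ0 ∅).trans (hκ' ∅)
  obtain ⟨L, hL0, hL⟩ := P.exists_bound_isSubgradientAt (‖P.xbar‖ + B)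
  have hdecr : ∀ n, 2 ≤ n → ∀ w, w ≤ T.wbar → T.cost (n + 1) 0 ≤ T.cost n w := fun n hn w hw => by
    rw [hrun.cost_next (by omega)]
    exact hrun.cost_le hassu hn hw le_rfl
  set cE : ℝ := ((Fintype.card (EdgeIdx P.G m) : ℕ) : ℝ)
  set cV : ℝ := ((Fintype.card V : ℕ) : ℝ)
  refine exists_rate_of_recursion (h := fun n => T.cost n 0 - cs)
    (A := (cE * (κ' * (2 * B)) + cV * (2 * B)) * (2 * T.wbar)) (A' := cV) (A'' := L + B)
    (by positivity) (by positivity) (by positivity) (fun n hn => sub_nonneg.2 (hopt n hn))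
    (fun n hn => sub_le_sub_right (hdecr n hn 0 (Nat.zero_le _)) _) fun n hn => ?_
  have hn1 : 1 ≤ n := by omega
  have hn2 : 2 ≤ n + 1 := by omega
  simp only [sub_sub_sub_cancel_right]
  set D := T.cost (n + 1) 0 - T.cost (n + 2) 0 with hD
  have hD0 : 0 ≤ D := sub_nonneg.2 (hdecr (n + 1) hn2 0 (Nat.zero_le _))
  -- The node data at the end of iteration n are those at the start of n + 1, where the first step
  -- acts on all of V₄; its decrease is at most D.
  have hδ : ∀ i, P.cls i = .V₄ → (P.f i (T.iter n T.wbar i)).toReal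
      - (⟪T.z n T.wbar (.inl i) i, T.iter n T.wbar i⟫_ℝ - T.conjVal n T.wbar (.inl i)) ≤
      D + (L + B) * √(2 * D) := by
    intro i hi
    have hS := hassu.first_step ⟨i, hi⟩ (n + 1) (by omega)
    have hin : T.StepInV4 (n + 1) (0 + 1) := fun a ha => (hS a).1 ha
    obtain ⟨s, hs, hgap⟩ := hrun.subalg_gap (n := n + 1) (w := 0) (by omega) hrun.wbar_pos hin
      (hrun.isFinite hassu hn2 0 (Nat.zero_le _)) ((hS (.inl i)).2 ⟨i, rfl, hi⟩)
    have hD' : T.cost (n + 1) 0 - T.cost (n + 1) (0 + 1) ≤ D :=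
      sub_le_sub_left (hdecr (n + 1) hn2 1 hrun.wbar_pos) _
    obtain ⟨hz1, hz2, -⟩ := hz (n + 1) hn2 0 (Nat.zero_le _)
    have hiter : ‖T.iter (n + 1) 0 i‖ ≤ ‖P.xbar‖ + B :=
      (PiLp.norm_apply_le _ i).trans ((norm_sub_le _ _).trans (add_le_add_right hz2 _))
    have hsn : ‖s - T.z (n + 1) 0 (.inl i) i‖ ≤ L + B :=
      (norm_sub_le _ _).trans (add_le_add (hL i hi _ s hiter hs)
        ((PiLp.norm_apply_le _ i).trans (hz1 i)))
    rw [hrun.iter_next hn1, hrun.next_node n hn1, hrun.conjVal_next hn1] at hgap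
    rw [hrun.next_node n hn1] at hsn
    refine hgap.trans (add_le_add ?_ (mul_le_mul hsn (Real.sqrt_le_sqrt ?_)
      (Real.sqrt_nonneg _) (by positivity)))
    · rw [← hrun.iter_next hn1] at *
      exact hD'
    · linarith
  obtain ⟨hz1, -, hz3⟩ := hz n hn T.wbar le_rfl
  have := hrun.gap_le hassu hn1 hr hκ'0
    (fun u hu => by
      obtain ⟨g, h1, h2, h3, h4⟩ := hdec (T.Ebar n) u hu
      exact ⟨g, h1, h2, h3, fun a => (h4 a).trans
        (mul_le_mul_of_nonneg_right (hκ' _) (norm_nonneg _))⟩)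
    hzs hzsE hz1 hz3 (fun w hw => hrun.norm_iter_sub_le hassu hn hw)
    (by positivity : 0 ≤ D + (L + B) * √(2 * D)) hδ
  rw [hrun.cost_next hn1]
  refine this.trans (le_of_eq ?_)
  ring

end Trace

end DistProblem

theorem mainTheorem5 {V : Type*} [Fintype V] {m : ℕ} (P : DistProblem V m)
    (xstar : Euc m) (hxstar : P.IsPrimalMinimizer xstar)
    (hCQ : P.ConstraintQualification xstar)
    (T : P.Trace) (hrun : T.IsRun) (hassu : T.StandingAssumptions) :
    (∃ B : ℝ, ∀ n w, 1 ≤ n → w ≤ T.wbar → ∀ i : V, ‖T.z n w (.inl i)‖ ≤ B) ∧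
    (∃ zstar, P.IsDualOptimizer zstar) ∧
    (∀ zstar, P.IsDualOptimizer zstar →
      (P.dualObj P.bigF zstar ≠ ⊥ ∧ P.dualObj P.bigF zstar ≠ ⊤) ∧
      (∀ n, 1 ≤ n → 0 ≤ P.dualObj P.bigF zstar - T.dualValue n 0) ∧
      ∃ C : ℝ, ∀ n : ℕ, 2 ≤ n →
        P.dualObj P.bigF zstar - T.dualValue n 0
          ≤ ((C / (n : ℝ) ^ (1 / 3 : ℝ) : ℝ) : EReal)) := by
  have hx := fun i => DistProblem.f_ne_top_of_isPrimalMinimizer hxstar i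
  -- The model dual value at the first iterate known to have finite cost. Later values are no
  -- smaller, and the true F lies above since models minorize f_i.
  set M := 1 / 2 * ‖P.xbar‖ ^ 2 - T.cost 2 0 with hM
  have hcost : ∀ n, 2 ≤ n → ∀ w, w ≤ T.wbar → T.cost n w ≤ T.cost 2 0 := by
    intro n hn
    induction n, hn using Nat.le_induction with
    | base => exact fun w hw => hrun.cost_le hassu le_rfl (Nat.zero_le _) hw
    | succ n hn ih =>
      intro w hw
      refine (hrun.cost_le hassu (by omega) (Nat.zero_le _) hw).trans ?_
      rw [hrun.cost_next (by omega)]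
      exact ih T.wbar le_rfl
  have hlow : ∀ n, 2 ≤ n → ∀ w, w ≤ T.wbar →
      (M : EReal) ≤ P.dualObj P.bigF (T.z n w) := by
    intro n hn w hw
    refine le_trans ?_ (hrun.invariant n (by omega) w hw).dualValue_le
    rw [DistProblem.Trace.dualValue_eq (hrun.isFinite hassu hn w hw), EReal.coe_le_coe_iff]
    exact sub_le_sub_left (hcost n hn w hw) _
  obtain ⟨B, hB⟩ := DistProblem.exists_bound_of_le_dualObj hx hCQ M
  have hM2 := hlow 2 le_rfl 0 (Nat.zero_le _)
  refine ⟨?_, DistProblem.exists_isDualOptimizer hx hCQ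
    (ne_bot_of_le_ne_bot (EReal.coe_ne_bot M) hM2), fun zs hzs => ?_⟩
  -- The first outer iteration, outside the level-set bound, contributes finitely many vectors.
  · obtain ⟨B₁, hB₁⟩ := Finite.exists_le
      fun q : Fin (T.wbar + 1) × V => ‖T.z 1 q.1 (.inl q.2)‖
    refine ⟨max B₁ B, fun n w hn hw i => ?_⟩
    rcases hn.eq_or_lt with rfl | hn
    · exact (hB₁ (⟨w, by omega⟩, i)).trans (le_max_left _ _)
    · exact ((hB _ (hlow n hn w hw)).1 i).trans (le_max_right _ _)
  · have hMs : (M : EReal) ≤ P.dualObj P.bigF zs := hM2.trans (hzs _)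
    have hbot := ne_bot_of_le_ne_bot (EReal.coe_ne_bot M) hMs
    have htop := DistProblem.dualObj_ne_top zs P.exists_bigF_ne_top
    have hle : ∀ n, 1 ≤ n → T.dualValue n 0 ≤ P.dualObj P.bigF zs := fun n hn =>
      (hrun.invariant n hn 0 (Nat.zero_le _)).dualValue_le.trans (hzs _)
    refine ⟨⟨hbot, htop⟩, fun n hn =>
      (EReal.sub_nonneg (Or.inl htop) (Or.inl hbot)).2 (hle n hn), ?_⟩
    obtain ⟨r, hr⟩ := DistProblem.exists_conj_of_dualObj_ne_bot P.exists_bigF_ne_top hbot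
    have hval := DistProblem.dualObj_eq_coe hr
    have hnval : ∀ n, 2 ≤ n → T.dualValue n 0 =
        ((1 / 2 * ‖P.xbar‖ ^ 2 - T.cost n 0 : ℝ) : EReal) := fun n hn =>
      DistProblem.Trace.dualValue_eq (hrun.isFinite hassu hn 0 (Nat.zero_le _))
    obtain ⟨hs1, -, hs3⟩ := hB zs hMs
    obtain ⟨C, hC⟩ := hrun.exists_rate hassu hr hs1 hs3
      (fun n hn w hw => hB _ (hlow n hn w hw)) fun n hn => by
        have := hle n (by omega)
        rw [hnval n hn, hval, EReal.coe_le_coe_iff] at this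
        linarith
    refine ⟨C, fun n hn => ?_⟩
    rw [hnval n hn, hval, ← EReal.coe_sub, EReal.coe_le_coe_iff]
    refine le_trans (le_of_eq ?_) (hC n hn)
    ring
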